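/- Let $(M,g)$ be a smooth Riemannian manifold of dimension $n$ and let $G$ be a Lie subgroup of $O(n)$, with Lie algebra $\mathfrak g\subset\mathfrak{so}(n)$ and tangent representation $V=\mathbb R^n$. Let $\mathfrak g^\perp$ be the orthogonal complement of $\mathfrak g$ in $\mathfrak{so}(n)$ with respect to the inner product $-\operatorname{tr}(AB)$. Let $P$ be a $G$-structure on $(M,g)$, that is, a smooth reduction of the bundle of orthonormal frames to $G$. A tensor field of type $(2,1)$ is said to take values in a subspace of $V\otimes\operatorname{End}V$ if its expression in every frame $p\in P$ lies in that subspace. Let $\nabla^g$ be the Levi-Civita connection, let $\tilde\nabla$ be the minimal connection, i.e. the unique connection on $TM$ that is induced by a connection on the principal bundle $P$ and for which $\xi:=\nabla^g-\tilde\nabla$ takes values in $V\otimes\mathfrak g^\perp$; the tensor $\xi$ is the intrinsic torsion of the $G$-structure. Assume that $\xi$ is skew-symmetric, i.e. that $(X,Y,Z)\mapsto g(\xi_XY,Z)$ is a three-form, and that $\xi$ takes values in a $G$-submodule $W$ of $V\otimes\mathfrak g^\perp$. If the only $G$-invariant element of $V\otimes W\otimes S^2W$ is $0$, then the intrinsic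 torsion is parallel with respect to the minimal connection: $\tilde\nabla\xi=0$. -/

import Mathlib

open Bundle Manifold
open scoped ContDiff TensorProduct

noncomputable section

namespace GStr

/-! ### Linear algebra of the tangent representation -/

/-- The Euclidean space `ℝⁿ`, the underlying space of the representation `V`. -/
abbrev Eu (n : ℕ) : Type := EuclideanSpace ℝ (Fin n)

/-- The orthogonal group `O(n)`, as the group of linear isometries of `ℝⁿ`. -/
abbrev On (n : ℕ) : Type := Eu n ≃ₗᵢ[ℝ] Eu n

variable {n : ℕ}

/-- The Lie algebra `so(n)` of skew-symmetric endomorphisms of `ℝⁿ`. -/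
def so (n : ℕ) : Submodule ℝ (Module.End ℝ (Eu n)) where
  carrier := {A | ∀ v w, inner ℝ (A v) w = -inner ℝ v (A w)}
  zero_mem' := by intro v w; simp
  add_mem' := by
    intro A B hA hB v w
    simp only [LinearMap.add_apply, inner_add_left, inner_add_right, hA v w, hB v w]
    ring
  smul_mem' := by
    intro c A hA v w
    simp only [LinearMap.smul_apply, real_inner_smul_left, real_inner_smul_right, hA v w]
    ring

/-- The Lie algebra `𝔤` of a subgroup `G` of `O(n)`, spanned by the endomorphisms `A` whose
one-parameter group `exp (tA)` lies in `G` (for a Lie subgroup these already form a linear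
space). -/
def lieAlg (G : Subgroup (On n)) : Submodule ℝ (Module.End ℝ (Eu n)) :=
  Submodule.span ℝ {A | ∀ t : ℝ, ∃ a ∈ G, ∀ v : Eu n,
    a v = NormedSpace.exp (t • LinearMap.toContinuousLinearMap A) v}

/-- The orthogonal complement `𝔤^⊥` of `𝔤` in `so(n)`, for the inner product `-tr (AB)`. -/
def lieAlgPerp (G : Subgroup (On n)) : Submodule ℝ (Module.End ℝ (Eu n)) where
  carrier := {B | B ∈ so n ∧ ∀ A ∈ lieAlg G, -LinearMap.trace ℝ (Eu n) (A * B) = 0}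
  zero_mem' := ⟨zero_mem _, by simp⟩
  add_mem' := by
    rintro B C ⟨hB, hB'⟩ ⟨hC, hC'⟩
    refine ⟨add_mem hB hC, fun A hA => ?_⟩
    have h1 := hB' A hA
    have h2 := hC' A hA
    rw [mul_add, map_add]
    linarith
  smul_mem' := by
    rintro c B ⟨hB, hB'⟩
    refine ⟨Submodule.smul_mem _ c hB, fun A hA => ?_⟩
    have h1 := hB' A hA
    rw [mul_smul_comm, map_smul, smul_eq_mul]
    linear_combination c * h1

/-- The representation `V` of `G` on `ℝⁿ`. -/
def repV (G : Subgroup (On n)) : Representation ℝ G (Eu n) where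
  toFun a := a.1.toLinearEquiv.toLinearMap
  map_one' := rfl
  map_mul' _ _ := rfl

/-- The space `V ⊗ End V` of tensors `α : X ↦ α_X`, where `V` is identified with its dual by
means of the metric. -/
abbrev Tors (n : ℕ) : Type := Eu n →ₗ[ℝ] Module.End ℝ (Eu n)

/-- The representation `V ⊗ End V` of `G`: `(a • α)_X Y = a (α_{a⁻¹ X} (a⁻¹ Y))`. -/
def repTors (G : Subgroup (On n)) : Representation ℝ G (Tors n) :=
  (repV G).linHom ((repV G).linHom (repV G))

/-- The subspace `V ⊗ 𝔤^⊥` of `V ⊗ End V`. -/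
def VPerp (G : Subgroup (On n)) : Submodule ℝ (Tors n) where
  carrier := {α | ∀ v, α v ∈ lieAlgPerp G}
  zero_mem' _ := zero_mem _
  add_mem' hα hβ v := add_mem (hα v) (hβ v)
  smul_mem' c _ hα v := Submodule.smul_mem _ c (hα v)

/-- The symmetric square `S²W` of a representation, as the subrepresentation of symmetric tensors
in `W ⊗ W`. -/
def symSq {G W : Type*} [Monoid G] [AddCommMonoid W] [Module ℝ W] (ρ : Representation ℝ G W) :
    Subrepresentation (ρ.tprod ρ) where
  toSubmodule := LinearMap.eqLocus (TensorProduct.comm ℝ W W).toLinearMap LinearMap.id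
  apply_mem_toSubmodule := by
    intro g t ht
    have key : ∀ u : W ⊗[ℝ] W, TensorProduct.comm ℝ W W ((ρ.tprod ρ) g u)
        = (ρ.tprod ρ) g (TensorProduct.comm ℝ W W u) := by
      intro u
      induction u with
      | zero => simp
      | tmul x y => simp
      | add x y hx hy => simp only [map_add, hx, hy]
    have ht' : TensorProduct.comm ℝ W W t = t := ht
    change TensorProduct.comm ℝ W W ((ρ.tprod ρ) g t) = (ρ.tprod ρ) g t
    rw [key, ht']

/-- The representation `V ⊗ W ⊗ S²W` of `G`. -/
def repVWSW (G : Subgroup (On n)) (W : Subrepresentation (repTors G)) :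
    Representation ℝ G
      (Eu n ⊗[ℝ] (W.toSubmodule ⊗[ℝ] (symSq W.toRepresentation).toSubmodule)) :=
  (repV G).tprod (W.toRepresentation.tprod (symSq W.toRepresentation).toRepresentation)

/-! ### `G`-structures and connections on a Riemannian manifold -/

section Manifold

variable (M : Type*) [TopologicalSpace M] [ChartedSpace (Eu n) M] [IsManifold (𝓡 n) ∞ M]

/-- Connections on the tangent bundle of `M`; `∇ Y x X` is `(∇_X Y)(x)`. -/
abbrev Conn : Type _ :=
  CovariantDerivative (𝓡 n) (Eu n) (fun x : M => TangentSpace (𝓡 n) x)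

/-- The `(2,1)`-tensor fields on `M`; `ξ x X Y` is `(ξ_X Y)(x)`. -/
abbrev TensorField : Type _ :=
  ∀ x : M, TangentSpace (𝓡 n) x →ₗ[ℝ] TangentSpace (𝓡 n) x →ₗ[ℝ] TangentSpace (𝓡 n) x

variable {M}

/-- The difference tensor `ξ = ∇ - ∇'` of two connections, `ξ_X Y = ∇_X Y - ∇'_X Y`. -/
def diffTensor (D D' : Conn (n := n) M) : TensorField (n := n) M :=
  fun x => (ContinuousLinearMap.coeLM ℝ ∘ₗ (D.difference D' x).toLinearMap).flip

/-- The covariant derivative of a `(2,1)`-tensor field, evaluated at `x` on a tangent vector `X`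
and on vector fields `Y`, `Z`:
`(∇_X ξ)_Y Z = ∇_X (ξ_Y Z) - ξ_{∇_X Y} Z - ξ_Y (∇_X Z)`. -/
def covDeriv (D : Conn (n := n) M) (ξ : TensorField (n := n) M) (x : M)
    (X : TangentSpace (𝓡 n) x) (Y Z : ∀ y : M, TangentSpace (𝓡 n) y) : TangentSpace (𝓡 n) x :=
  D (fun y => ξ y (Y y) (Z y)) x X - ξ x (D Y x X) (Z x) - ξ x (Y x) (D Z x X)

/-- The tensor field `ξ` is parallel: `∇ξ = 0`. -/
def IsParallel (D : Conn (n := n) M) (ξ : TensorField (n := n) M) : Prop :=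
  ∀ (x : M) (X : TangentSpace (𝓡 n) x) (Y Z : ∀ y : M, TangentSpace (𝓡 n) y),
    MDifferentiableAt (𝓡 n) ((𝓡 n).prod 𝓘(ℝ, Eu n))
      (fun y => (⟨y, Y y⟩ : TangentBundle (𝓡 n) M)) x →
    MDifferentiableAt (𝓡 n) ((𝓡 n).prod 𝓘(ℝ, Eu n))
      (fun y => (⟨y, Z y⟩ : TangentBundle (𝓡 n) M)) x →
    covDeriv D ξ x X Y Z = 0

variable [RiemannianBundle (fun x : M => TangentSpace (𝓡 n) x)]

/-- `ξ` is skew-symmetric: `g(ξ_X Y, Z)` is a three-form. -/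
def IsSkew (ξ : TensorField (n := n) M) : Prop :=
  ∀ (x : M) (X Y Z : TangentSpace (𝓡 n) x),
    inner ℝ (ξ x X Y) Z = -inner ℝ (ξ x Y X) Z ∧ inner ℝ (ξ x X Y) Z = -inner ℝ (ξ x X Z) Y

variable (M) in
/-- A `G`-structure on the Riemannian manifold `M`: a reduction `P` to `G` of the bundle of
orthonormal frames `p : ℝⁿ → T_x M`, on which `O(n)` acts by `p · a = p ∘ a`. -/
structure GStructure (G : Subgroup (On n)) where
  /-- The frames at `x` that belong to the reduction. -/
  frames : ∀ x : M, Set (Eu n ≃ₗᵢ[ℝ] TangentSpace (𝓡 n) x)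
  /-- `G` acts on each fibre. -/
  act_mem : ∀ (x : M), ∀ p ∈ frames x, ∀ a ∈ G, a.trans p ∈ frames x
  /-- `G` acts transitively on each fibre. -/
  transitive : ∀ (x : M), ∀ p ∈ frames x, ∀ q ∈ frames x, ∃ a ∈ G, q = a.trans p
  /-- Every point has a neighbourhood with a smooth section of `P`. -/
  exists_section : ∀ x : M, ∃ (U : Set M) (s : ∀ y : M, Eu n ≃ₗᵢ[ℝ] TangentSpace (𝓡 n) y),
    IsOpen U ∧ x ∈ U ∧ (∀ y ∈ U, s y ∈ frames y) ∧
    ∀ v : Eu n, ContMDiffOn (𝓡 n) ((𝓡 n).prod 𝓘(ℝ, Eu n)) ∞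
      (fun y => (⟨y, s y v⟩ : TangentBundle (𝓡 n) M)) U

/-- `s` is a smooth local section of the `G`-structure over the open set `U`
(its values outside `U` are irrelevant). -/
structure GStructure.IsLocalSection {G : Subgroup (On n)} (P : GStructure M G) (U : Set M)
    (s : ∀ y : M, Eu n ≃ₗᵢ[ℝ] TangentSpace (𝓡 n) y) : Prop where
  isOpen : IsOpen U
  mem : ∀ y ∈ U, s y ∈ P.frames y
  smooth : ∀ v : Eu n, ContMDiffOn (𝓡 n) ((𝓡 n).prod 𝓘(ℝ, Eu n)) ∞
    (fun y => (⟨y, s y v⟩ : TangentBundle (𝓡 n) M)) U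

/-- A `G`-connection: a smooth connection that comes from a connection on the principal bundle `P`,
that is, whose connection form `A` in each local section `s` of `P`, given by
`∇_X (s v) = s (A_X v)`, takes values in `𝔤`. -/
structure IsGConnection {G : Subgroup (On n)} (P : GStructure M G) (D : Conn (n := n) M) :
    Prop where
  smooth : D.ContMDiffCovariantDerivative ∞
  form_mem : ∀ (U : Set M) (s : ∀ y : M, Eu n ≃ₗᵢ[ℝ] TangentSpace (𝓡 n) y),
    P.IsLocalSection U s → ∀ x ∈ U, ∀ X : TangentSpace (𝓡 n) x,
      ∃ A ∈ lieAlg G, ∀ v : Eu n, D (fun y => s y v) x X = s x (A v)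

/-- The expression of a tensor at `x` in a frame `p : ℝⁿ → T_x M`, an element of `V ⊗ End V`:
`(p^* ξ)_v w = p⁻¹ (ξ_{p v} (p w))`. -/
def inFrame {x : M} (p : Eu n ≃ₗᵢ[ℝ] TangentSpace (𝓡 n) x)
    (ξ : TangentSpace (𝓡 n) x →ₗ[ℝ] TangentSpace (𝓡 n) x →ₗ[ℝ] TangentSpace (𝓡 n) x) :
    Tors n where
  toFun v := p.symm.toLinearEquiv.toLinearMap ∘ₗ ξ (p v) ∘ₗ
    p.toLinearEquiv.toLinearMap
  map_add' v w := by ext; simp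
  map_smul' c v := by ext; simp

/-- The tensor field `ξ` takes values in the subspace `W` of `V ⊗ End V`. -/
def TakesValuesIn {G : Subgroup (On n)} (P : GStructure M G) (ξ : TensorField (n := n) M)
    (W : Submodule ℝ (Tors n)) : Prop :=
  ∀ (x : M), ∀ p ∈ P.frames x, inFrame p (ξ x) ∈ W

/-- `D` is the minimal connection of the `G`-structure `P`: the `G`-connection for which
`∇^g - D` takes values in `V ⊗ 𝔤^⊥`, where `∇^g` is the Levi-Civita connection. The tensor field
`∇^g - D` is then the intrinsic torsion. -/
structure IsMinimalConnection {G : Subgroup (On n)} (P : GStructure M G) (Dg D : Conn (n := n) M) :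
    Prop where
  isGConnection : IsGConnection P D
  mem_perp : TakesValuesIn P (diffTensor Dg D) (VPerp G)

variable [IsContMDiffRiemannianBundle (𝓡 n) ∞ (Eu n) (fun x : M => TangentSpace (𝓡 n) x)]

instance isContMDiffRiemannianBundle_one :
    IsContMDiffRiemannianBundle (𝓡 n) 1 (Eu n) (fun x : M => TangentSpace (𝓡 n) x) :=
  IsContMDiffRiemannianBundle.of_le (n := ∞) (by simp)

/-- `D` is the Levi-Civita connection: smooth, metric and torsion-free. -/
structure IsLeviCivita (D : Conn (n := n) M) : Prop where
  smooth : D.ContMDiffCovariantDerivative ∞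
  metric : D.IsMetricCompatible
  torsion_eq_zero : D.torsion = 0

end Manifold

end GStr

end

noncomputable section

set_option synthInstance.maxHeartbeats 200000
set_option linter.unusedSectionVars false

namespace GStr

open Filter Topology

variable {n : ℕ}

/-! ### Derivatives of maps into a subspace -/

/-! Work in a local section `s` of `P`. Let `a` be the coefficients of the minimal connection there,
`Ω` its curvature, `ξ` the torsion, and `φ` the covariant derivative of `ξ` (`covDiffCoeff`). Since
`a + ξ` is torsion-free, it gives the brackets of the frame fields, and their Jacobi identity
becomes the first Bianchi identity of a connection with torsion `-2ξ` (`cyclic_curv_eq`): the cyclic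
sum of `Ω` is `-2` times that of `φ` plus `4` times that of `N = ξ_{ξ_u v} w`.

Three facts constrain the terms. `Ω` takes values in `𝔤`, because `𝔤` is closed under brackets
(`commutator_mem_lieAlgC`). Each `φ_u` is a three-form lying in `W`, because `W` is stable under `𝔤`
(`derivAct_mem`); hence it is orthogonal to `𝔤`. Finally, `⟨φ_u, psi u ξ ξ⟩ = 0`: this is the value
of a `G`-invariant linear form on `V ⊗ W ⊗ S²W`, and on an orthogonal representation such a form is
dual to an invariant vector (`contr_psi_eq_zero`).

Contracting the Bianchi identity with `φ_{ijkl}` and with `φ_{lijk}` gives two relations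
(`eq_zero_of_bianchi`). Eliminating `Ω` between them leaves only the quadratic terms that `psi`
collects, and these vanish. What remains says that `φ` is symmetric in its first two indices. Being
skew in the second and third as well, it is zero. -/

/-- The derivative of a map that takes values in a linear subspace takes values there. -/
lemma mfderiv_apply_mem_submodule {E H M F : Type*} [NormedAddCommGroup E] [NormedSpace ℝ E]
    [TopologicalSpace H] {I : ModelWithCorners ℝ E H} [TopologicalSpace M] [ChartedSpace H M]
    [NormedAddCommGroup F] [NormedSpace ℝ F] [FiniteDimensional ℝ F] (S : Submodule ℝ F)
    {f : M → F} {x : M} (hf : MDifferentiableAt I 𝓘(ℝ, F) f x) (hS : ∀ᶠ y in 𝓝 x, f y ∈ S)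
    (X : TangentSpace I x) : (mfderiv I 𝓘(ℝ, F) f x X : F) ∈ S := by
  -- A functional that kills `S` but not the derivative would have composite zero with `f` near `x`,
  -- so zero derivative.
  by_contra hX
  obtain ⟨l, hlX, hl⟩ := Submodule.exists_le_ker_of_notMem (V := F) hX
  have hl0 : ∀ s ∈ S, l s = 0 := fun s hs => hl hs
  apply hlX
  let L : F →L[ℝ] ℝ := LinearMap.toContinuousLinearMap l
  have h1 : HasMFDerivAt I 𝓘(ℝ, ℝ) (L ∘ f) x (L.comp (mfderiv I 𝓘(ℝ, F) f x)) :=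
    L.hasMFDerivAt.comp x hf.hasMFDerivAt
  have h2 : HasMFDerivAt I 𝓘(ℝ, ℝ) (L ∘ f) x 0 :=
    (hasMFDerivAt_const (0 : ℝ) x).congr_of_eventuallyEq
      (hS.mono fun y hy => by simpa [L] using hl0 _ hy)
  have h3 := hasMFDerivAt_unique h1 h2
  exact congrArg (fun T => T X) h3

lemma hasDerivAt_mem_submodule {F : Type*} [NormedAddCommGroup F] [NormedSpace ℝ F]
    [FiniteDimensional ℝ F] (S : Submodule ℝ F) {f : ℝ → F} {f' : F} {t : ℝ}
    (hf : HasDerivAt f f' t) (hS : ∀ u, f u ∈ S) : f' ∈ S := by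
  have h := mfderiv_apply_mem_submodule S hf.differentiableAt.mdifferentiableAt
    (Eventually.of_forall hS) (1 : ℝ)
  rw [mfderiv_eq_fderiv] at h
  rw [← hf.deriv]
  exact h

/-! ### The Lie algebra of `G` -/

/-- The endomorphisms whose one-parameter group lies in `G`. -/
def lieGen (G : Subgroup (On n)) : Set (Eu n →L[ℝ] Eu n) :=
  {A | ∀ t : ℝ, ∃ a ∈ G, ∀ v : Eu n, a v = NormedSpace.exp (t • A) v}

/-- `𝔤` as a space of continuous endomorphisms. -/
def lieAlgC (G : Subgroup (On n)) : Submodule ℝ (Eu n →L[ℝ] Eu n) :=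
  Submodule.span ℝ (lieGen G)

/-- Both sides are spans of the same generators. The continuous version carries the norm needed for
exponentials and derivatives. -/
lemma mem_lieAlgC_iff {G : Subgroup (On n)} {A : Eu n →L[ℝ] Eu n} :
    A ∈ lieAlgC G ↔ A.toLinearMap ∈ lieAlg G := by
  have : lieAlg G = (lieAlgC G).map
      (LinearMap.toContinuousLinearMap (E := Eu n) (F' := Eu n) (𝕜 := ℝ)).symm.toLinearMap := by
    rw [lieAlgC, Submodule.map_span, lieAlg]
    congr 1
    ext B
    constructor
    · intro hB
      exact ⟨LinearMap.toContinuousLinearMap B, hB, by simp⟩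
    · rintro ⟨C, hC, rfl⟩
      intro t
      simpa using! hC t
  rw [this]
  constructor
  · intro h
    exact ⟨A, h, rfl⟩
  · rintro ⟨B, hB, h⟩
    have : B = A := by
      ext v : 1
      exact congrArg (fun T : Eu n →ₗ[ℝ] Eu n => T v) h
    rwa [← this]

/-! ### One-parameter groups and conjugation. -/

section Exponential

lemma exp_zero_smul {𝔸 : Type*} [NormedRing 𝔸] [NormedAlgebra ℝ 𝔸] (A : 𝔸) :
    NormedSpace.exp ((0 : ℝ) • A) = 1 := by
  simp

variable {𝔸 : Type*} [NormedRing 𝔸] [NormedAlgebra ℝ 𝔸] [CompleteSpace 𝔸]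

lemma exp_smul_mul_exp_neg_smul (A : 𝔸) (t : ℝ) :
    NormedSpace.exp (t • A) * NormedSpace.exp ((-t) • A) = 1 := by
  let _ : NormedAlgebra ℚ 𝔸 := NormedAlgebra.restrictScalars ℚ ℝ 𝔸
  rw [neg_smul, ← NormedSpace.exp_add_of_commute (Commute.refl (t • A)).neg_right, add_neg_cancel,
    NormedSpace.exp_zero]

/-- The invertible element `exp (tA)`. -/
def expUnit (A : 𝔸) (t : ℝ) : 𝔸ˣ where
  val := NormedSpace.exp (t • A)
  inv := NormedSpace.exp ((-t) • A)
  val_inv := exp_smul_mul_exp_neg_smul A t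
  inv_val := by simpa using exp_smul_mul_exp_neg_smul A (-t)

lemma exp_smul_conj_exp (A B : 𝔸) (s t : ℝ) :
    NormedSpace.exp (s • (NormedSpace.exp (t • A) * B * NormedSpace.exp ((-t) • A)))
      = NormedSpace.exp (t • A) * NormedSpace.exp (s • B) * NormedSpace.exp ((-t) • A) := by
  let _ : NormedAlgebra ℚ 𝔸 := NormedAlgebra.restrictScalars ℚ ℝ 𝔸
  have := NormedSpace.exp_units_conj (expUnit A t) (s • B)
  rw [mul_smul_comm, smul_mul_assoc] at this
  exact this

lemma hasDerivAt_exp_smul_zero (A : 𝔸) :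
    HasDerivAt (fun t : ℝ => NormedSpace.exp (t • A)) A 0 := by
  simpa using hasDerivAt_exp_smul_const (𝕂 := ℝ) A (0 : ℝ)

lemma hasDerivAt_exp_neg_smul_zero (A : 𝔸) :
    HasDerivAt (fun t : ℝ => NormedSpace.exp ((-t) • A)) (-A) 0 := by
  simpa using hasDerivAt_exp_smul_zero (-A)

/-- The commutator is the derivative at `t = 0` of a curve that stays in `S`. -/
lemma commutator_mem_of_conj_exp_mem [FiniteDimensional ℝ 𝔸] {S : Submodule ℝ 𝔸} {A B : 𝔸}
    (h : ∀ t : ℝ, NormedSpace.exp (t • A) * B * NormedSpace.exp ((-t) • A) ∈ S) :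
    A * B - B * A ∈ S := by
  refine hasDerivAt_mem_submodule S
    (f := fun t : ℝ => NormedSpace.exp (t • A) * B * NormedSpace.exp ((-t) • A)) (t := 0) ?_ h
  have := ((hasDerivAt_exp_smul_zero A).mul_const B).mul (hasDerivAt_exp_neg_smul_zero A)
  simpa [sub_eq_add_neg] using! this

end Exponential

/-- For a generator, differentiate the constant function `⟨exp(tA) v, exp(tA) w⟩` at `0`; the
condition is linear in `A`. -/
lemma inner_apply_of_mem_lieAlgC {G : Subgroup (On n)} {A : Eu n →L[ℝ] Eu n}
    (hA : A ∈ lieAlgC G) (v w : Eu n) : inner ℝ (A v) w = -inner ℝ v (A w) := by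
  induction hA using Submodule.span_induction with
  | mem A hA =>
    have h1 : HasDerivAt (fun t : ℝ => inner ℝ (NormedSpace.exp (t • A) v)
        (NormedSpace.exp (t • A) w)) (inner ℝ v (A w) + inner ℝ (A v) w) 0 := by
      have hv := (hasDerivAt_exp_smul_zero A).clm_apply (hasDerivAt_const (0 : ℝ) v)
      have hw := (hasDerivAt_exp_smul_zero A).clm_apply (hasDerivAt_const (0 : ℝ) w)
      simpa [exp_zero_smul A] using! hv.inner ℝ hw
    have h2 : HasDerivAt (fun t : ℝ => inner ℝ (NormedSpace.exp (t • A) v)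
        (NormedSpace.exp (t • A) w)) 0 0 := by
      have : (fun t : ℝ => inner ℝ (NormedSpace.exp (t • A) v) (NormedSpace.exp (t • A) w))
          = fun _ => inner ℝ v w := by
        ext t
        obtain ⟨a, -, ha⟩ := hA t
        rw [← ha, ← ha, a.inner_map_map]
      rw [this]
      exact hasDerivAt_const _ _
    linarith [h1.unique h2]
  | zero => simp
  | add A B _ _ hA hB =>
    simp only [add_apply, inner_add_left, inner_add_right, hA, hB]
    ring
  | smul c A _ hA =>
    simp only [smul_apply, real_inner_smul_left, real_inner_smul_right, hA]
    ring

/-- Conjugating a one-parameter group of `G` by an element of `G` gives another one in `G`. -/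
lemma conj_exp_mem_lieGen {G : Subgroup (On n)} {A B : Eu n →L[ℝ] Eu n} (hA : A ∈ lieGen G)
    (hB : B ∈ lieGen G) (t : ℝ) :
    NormedSpace.exp (t • A) * B * NormedSpace.exp ((-t) • A) ∈ lieGen G := by
  intro s
  obtain ⟨a, haG, ha⟩ := hA t
  obtain ⟨a', haG', ha'⟩ := hA (-t)
  obtain ⟨b, hbG, hb⟩ := hB s
  refine ⟨a * b * a', G.mul_mem (G.mul_mem haG hbG) haG', fun v => ?_⟩
  refine Eq.trans ?_ (congrArg (fun T : Eu n →L[ℝ] Eu n => T v) (exp_smul_conj_exp A B s t).symm)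
  change a (b (a' v)) = _
  rw [ha, hb, ha']
  rfl

/-- As `𝔤` is defined as a span, for any subgroup, closure under brackets needs proof. Bilinearity
reduces it to generators, where conjugation by `exp(tA)` can be differentiated. -/
lemma commutator_mem_lieAlgC {G : Subgroup (On n)} {A B : Eu n →L[ℝ] Eu n}
    (hA : A ∈ lieAlgC G) (hB : B ∈ lieAlgC G) : A * B - B * A ∈ lieAlgC G := by
  induction hA using Submodule.span_induction with
  | mem A hA =>
    induction hB using Submodule.span_induction with
    | mem B hB =>
      exact commutator_mem_of_conj_exp_mem fun t =>
        Submodule.subset_span (conj_exp_mem_lieGen hA hB t)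
    | zero => simp
    | add B C _ _ hB hC =>
      rw [show A * (B + C) - (B + C) * A = (A * B - B * A) + (A * C - C * A) by noncomm_ring]
      exact add_mem hB hC
    | smul c B _ hB =>
      have h : A * (c • B) - (c • B) * A = c • (A * B - B * A) := by
        ext v : 1
        simp [smul_sub]
      rw [h]
      exact Submodule.smul_mem _ c hB
  | zero => simp
  | add A C _ _ hA hC =>
    rw [show (A + C) * B - B * (A + C) = (A * B - B * A) + (C * B - B * C) by noncomm_ring]
    exact add_mem hA hC
  | smul c A _ hA =>
    have h : (c • A) * B - B * (c • A) = c • (A * B - B * A) := by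
      ext v : 1
      simp [smul_sub]
    rw [h]
    exact Submodule.smul_mem _ c hA

/-! ### The action of `𝔤` on tensors -/

section Conjugation

variable {E : Type*} [NormedAddCommGroup E] [NormedSpace ℝ E]

/-- The derivation action of an endomorphism on tensors,
`(A • α)_X Y = A (α_X Y) - α_{A X} Y - α_X (A Y)`. -/
def derivAct (A : E →L[ℝ] E) (α : E →L[ℝ] E →L[ℝ] E) : E →L[ℝ] E →L[ℝ] E :=
  ContinuousLinearMap.compL ℝ E E E A ∘L α - α ∘L A -
    (ContinuousLinearMap.compL ℝ E E E).flip A ∘L α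

@[simp] lemma derivAct_apply (A : E →L[ℝ] E) (α : E →L[ℝ] E →L[ℝ] E) (v w : E) :
    derivAct A α v w = A (α v w) - α (A v) w - α v (A w) := rfl

/-- The product rule for `P(t) α(Q(t)·, Q(t)·)`, where `P` and `Q` stand for `exp(tA)` and
`exp(-tA)`: the derivation action is the differential of the group action. -/
lemma hasDerivAt_conj {A : E →L[ℝ] E} (α : E →L[ℝ] E →L[ℝ] E) {P Q : ℝ → E →L[ℝ] E}
    (hP : HasDerivAt P A 0) (hQ : HasDerivAt Q (-A) 0) (hP0 : P 0 = 1) (hQ0 : Q 0 = 1) :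
    HasDerivAt (fun t => ContinuousLinearMap.compL ℝ E E E (P t) ∘L
      ((ContinuousLinearMap.compL ℝ E E E).flip (Q t) ∘L (α ∘L Q t))) (derivAct A α) 0 := by
  have k1 := (ContinuousLinearMap.compL ℝ E E E).hasFDerivAt.comp_hasDerivAt (0 : ℝ) hP
  have k2 := (ContinuousLinearMap.compL ℝ E E E).flip.hasFDerivAt.comp_hasDerivAt (0 : ℝ) hQ
  convert! k1.clm_comp (k2.clm_comp ((hasDerivAt_const (0 : ℝ) α).clm_comp hQ)) using 1
  ext v w : 2
  simp [derivAct_apply, hP0, hQ0]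
  abel

end Conjugation

/-- Continuous tensors of type `(2,1)` on `ℝⁿ`. -/
abbrev Tc (n : ℕ) : Type := Eu n →L[ℝ] Eu n →L[ℝ] Eu n

/-- The linear map that forgets continuity. -/
def toTors : Tc n →ₗ[ℝ] Tors n where
  toFun α := ContinuousLinearMap.coeLM ℝ ∘ₗ α.toLinearMap
  map_add' _ _ := rfl
  map_smul' _ _ := rfl

/-- The orbit of `α` under a one-parameter group of `G` stays in `W`, hence so does its velocity. -/
lemma derivAct_mem {G : Subgroup (On n)} (W : Subrepresentation (repTors G))
    {A : Eu n →L[ℝ] Eu n} (hA : A ∈ lieAlgC G) {α : Tc n} (hα : toTors α ∈ W.toSubmodule) :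
    toTors (derivAct A α) ∈ W.toSubmodule := by
  change derivAct A α ∈ W.toSubmodule.comap toTors
  induction hA using Submodule.span_induction with
  | mem A hA =>
    refine hasDerivAt_mem_submodule _ (hasDerivAt_conj α (hasDerivAt_exp_smul_zero A)
      (hasDerivAt_exp_neg_smul_zero A) (exp_zero_smul A) (by rw [neg_zero, exp_zero_smul A])) ?_
    · intro t
      obtain ⟨a, haG, ha⟩ := hA t
      have := W.apply_mem_toSubmodule ⟨a, haG⟩ hα
      have hinv : ∀ v, a⁻¹ v = NormedSpace.exp ((-t) • A) v := fun v => by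
        apply a.injective
        have e : a (a⁻¹ v) = v := a.apply_symm_apply v
        rw [e, ha]
        exact (congrArg (fun T : Eu n →L[ℝ] Eu n => T v) (exp_smul_mul_exp_neg_smul A t)).symm
      rw [Submodule.mem_comap]
      convert this using 1
      ext v w : 2
      change NormedSpace.exp (t • A) (α (NormedSpace.exp ((-t) • A) v)
        (NormedSpace.exp ((-t) • A) w)) = a (α (a⁻¹ v) (a⁻¹ w))
      rw [ha, hinv, hinv]
  | zero =>
    convert Submodule.zero_mem _
    ext v w : 2
    simp
  | add A B _ _ hA hB =>
    convert add_mem hA hB using 1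
    ext v w : 2
    simp
    abel
  | smul c A _ hA =>
    convert Submodule.smul_mem _ c hA using 1
    ext v w : 2
    simp [smul_sub]

/-! ### Invariant linear forms on orthogonal representations -/

lemma apply_tprod_tprod_of_tmul {G U V W : Type*} [Monoid G] [AddCommMonoid U] [Module ℝ U]
    [AddCommMonoid V] [Module ℝ V] [AddCommMonoid W] [Module ℝ W] {ρ : Representation ℝ G U}
    {σ : Representation ℝ G V} {τ : Representation ℝ G W} {F : U ⊗[ℝ] (V ⊗[ℝ] W) →ₗ[ℝ] ℝ}
    (h : ∀ g u v w, F (ρ g u ⊗ₜ (σ g v ⊗ₜ τ g w)) = F (u ⊗ₜ (v ⊗ₜ w))) (g : G)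
    (x : U ⊗[ℝ] (V ⊗[ℝ] W)) : F (ρ.tprod (σ.tprod τ) g x) = F x := by
  induction x with
  | zero => simp
  | add s t hs ht => simp only [map_add, hs, ht]
  | tmul u y =>
    induction y with
    | zero => simp
    | add s t hs ht => simp only [TensorProduct.tmul_add, map_add, hs, ht]
    | tmul v w => exact h g u v w

section Orthogonal

variable {G : Type*} [Group G] {V W : Type*} [NormedAddCommGroup V] [InnerProductSpace ℝ V]
  [NormedAddCommGroup W] [InnerProductSpace ℝ W]

/-- The representation preserves the inner product. -/
def IsOrthogonalRep (ρ : Representation ℝ G V) : Prop :=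
  ∀ g x y, inner ℝ (ρ g x) (ρ g y) = inner ℝ x y

lemma IsOrthogonalRep.tprod {ρ : Representation ℝ G V} {σ : Representation ℝ G W}
    (hρ : IsOrthogonalRep ρ) (hσ : IsOrthogonalRep σ) : IsOrthogonalRep (ρ.tprod σ) :=
  fun g x y => TensorProduct.inner_map_map ((ρ g).isometryOfInner (hρ g))
    ((σ g).isometryOfInner (hσ g)) x y

lemma IsOrthogonalRep.toRepresentation {ρ : Representation ℝ G V} (hρ : IsOrthogonalRep ρ)
    (S : Subrepresentation ρ) : IsOrthogonalRep S.toRepresentation :=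
  fun g x y => hρ g x y

/-- If an orthogonal representation has no invariants, then it has no invariant linear forms. -/
lemma IsOrthogonalRep.eq_zero_of_invariants_eq_bot [FiniteDimensional ℝ V]
    {ρ : Representation ℝ G V} (hρ : IsOrthogonalRep ρ) (h : ρ.invariants = ⊥)
    {F : V →ₗ[ℝ] ℝ} (hF : ∀ g x, F (ρ g x) = F x) : F = 0 := by
  have := FiniteDimensional.complete ℝ V
  -- The Riesz vector of an invariant form is invariant. Orthogonality of `ρ` suffices, so `G` need
  -- not be compact.
  set x := (InnerProductSpace.toDual ℝ V).symm (LinearMap.toContinuousLinearMap F)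
  have hx : ∀ y, inner ℝ x y = F y := fun y => by simp [x]
  have hxinv : x ∈ ρ.invariants := fun g => by
    refine ext_inner_right ℝ fun y => ?_
    have hy : ρ g (ρ g⁻¹ y) = y := by
      rw [← Module.End.mul_apply, ← map_mul, mul_inv_cancel, map_one, Module.End.one_apply]
    calc inner ℝ (ρ g x) y = inner ℝ (ρ g x) (ρ g (ρ g⁻¹ y)) := by rw [hy]
      _ = inner ℝ x y := by rw [hρ, hx, hx, hF]
  rw [h, Submodule.mem_bot] at hxinv
  ext y
  rw [← hx, hxinv, inner_zero_left, LinearMap.zero_apply]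

lemma IsOrthogonalRep.tprod_tprod_symSq [FiniteDimensional ℝ V] [FiniteDimensional ℝ W]
    {ρ : Representation ℝ G V} {σ : Representation ℝ G W}
    (hρ : IsOrthogonalRep ρ) (hσ : IsOrthogonalRep σ)
    (h : (ρ.tprod (σ.tprod (symSq σ).toRepresentation)).invariants = ⊥)
    {F : V ⊗[ℝ] (W ⊗[ℝ] (symSq σ).toSubmodule) →ₗ[ℝ] ℝ}
    (hF : ∀ g x, F (ρ.tprod (σ.tprod (symSq σ).toRepresentation) g x) = F x) : F = 0 :=
  (hρ.tprod (hσ.tprod ((hσ.tprod hσ).toRepresentation _))).eq_zero_of_invariants_eq_bot h hF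

end Orthogonal

/-! ### The inner product of `V ⊗ End V` -/

/-- Both sums are the trace of the endomorphism that represents `B`. -/
lemma sum_bilin_orthonormalBasis {ι : Type*} [Fintype ι] (u u' : OrthonormalBasis ι ℝ (Eu n))
    (B : Eu n →ₗ[ℝ] Eu n →ₗ[ℝ] ℝ) : ∑ i, B (u i) (u i) = ∑ i, B (u' i) (u' i) := by
  let T : Module.End ℝ (Eu n) := (InnerProductSpace.toDual ℝ (Eu n)).symm.toLinearEquiv.toLinearMap
    ∘ₗ (LinearMap.toContinuousLinearMap (𝕜 := ℝ) (E := Eu n) (F' := ℝ)).toLinearMap ∘ₗ B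
  have hT : ∀ x y, inner ℝ y (T x) = B x y := fun x y => by
    rw [real_inner_comm]
    simp [T]
  simp only [← hT]
  rw [← LinearMap.trace_eq_sum_inner T u, ← LinearMap.trace_eq_sum_inner T u']

/-- The inner product on `V ⊗ End V`. -/
def contr : Tors n →ₗ[ℝ] Tors n →ₗ[ℝ] ℝ :=
  LinearMap.mk₂ ℝ (fun α β => ∑ i, ∑ j, inner ℝ
      (α (EuclideanSpace.basisFun (Fin n) ℝ i) (EuclideanSpace.basisFun (Fin n) ℝ j))
      (β (EuclideanSpace.basisFun (Fin n) ℝ i) (EuclideanSpace.basisFun (Fin n) ℝ j)))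
    (fun α α' β => by simp [inner_add_left, Finset.sum_add_distrib])
    (fun c α β => by simp [real_inner_smul_left, Finset.mul_sum])
    (fun α β β' => by simp [inner_add_right, Finset.sum_add_distrib])
    (fun c α β => by simp [real_inner_smul_right, Finset.mul_sum])

lemma contr_apply (α β : Tors n) : contr α β = ∑ i, ∑ j, inner ℝ
      (α (EuclideanSpace.basisFun (Fin n) ℝ i) (EuclideanSpace.basisFun (Fin n) ℝ j))
      (β (EuclideanSpace.basisFun (Fin n) ℝ i) (EuclideanSpace.basisFun (Fin n) ℝ j)) :=
  LinearMap.mk₂_apply _ _ _ _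

/-- The basis is exchanged in one slot at a time. This freedom of basis is what makes `contr`
invariant under `G`. -/
lemma contr_eq_sum (u : OrthonormalBasis (Fin n) ℝ (Eu n)) (α β : Tors n) :
    contr α β = ∑ i, ∑ j, inner ℝ (α (u i) (u j)) (β (u i) (u j)) := by
  set b := EuclideanSpace.basisFun (Fin n) ℝ
  calc contr α β = ∑ i, ∑ j, inner ℝ (α (b i) (b j)) (β (b i) (b j)) := contr_apply α β
    _ = ∑ i, ∑ j, inner ℝ (α (b i) (u j)) (β (b i) (u j)) :=
      Finset.sum_congr rfl fun i _ =>
        sum_bilin_orthonormalBasis b u ((innerₗ (Eu n)).compl₁₂ (α (b i)) (β (b i)))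
    _ = ∑ j, ∑ i, inner ℝ (α (b i) (u j)) (β (b i) (u j)) := Finset.sum_comm
    _ = ∑ j, ∑ i, inner ℝ (α (u i) (u j)) (β (u i) (u j)) :=
      Finset.sum_congr rfl fun j _ =>
        sum_bilin_orthonormalBasis b u ((innerₗ (Eu n)).compl₁₂ (α.flip (u j)) (β.flip (u j)))
    _ = _ := Finset.sum_comm

lemma contr_comm (α β : Tors n) : contr α β = contr β α := by
  simp only [contr_apply, real_inner_comm]

lemma contr_self_nonneg (α : Tors n) : 0 ≤ contr α α := by
  rw [contr_apply]
  exact Finset.sum_nonneg fun _ _ => Finset.sum_nonneg fun _ _ => real_inner_self_nonneg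

lemma eq_zero_of_contr_self_eq_zero {α : Tors n} (h : contr α α = 0) : α = 0 := by
  rw [contr_apply] at h
  refine (EuclideanSpace.basisFun (Fin n) ℝ).toBasis.ext fun i =>
    (EuclideanSpace.basisFun (Fin n) ℝ).toBasis.ext fun j => ?_
  have h1 := (Finset.sum_eq_zero_iff_of_nonneg fun _ _ => Finset.sum_nonneg fun _ _ =>
    real_inner_self_nonneg).1 h i (Finset.mem_univ i)
  have h2 := (Finset.sum_eq_zero_iff_of_nonneg fun _ _ =>
    real_inner_self_nonneg).1 h1 j (Finset.mem_univ j)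
  simpa only [OrthonormalBasis.coe_toBasis, LinearMap.zero_apply] using inner_self_eq_zero.1 h2

lemma repTors_apply {G : Subgroup (On n)} (g : G) (α : Tors n) (v w : Eu n) :
    repTors G g α v w = g.1 (α (g.1⁻¹ v) (g.1⁻¹ w)) := rfl

/-- Evaluating the right side in the basis moved by `g⁻¹` matches the two sums term by term. -/
lemma contr_repTors {G : Subgroup (On n)} (g : G) (α β : Tors n) :
    contr (repTors G g α) (repTors G g β) = contr α β := by
  rw [contr_eq_sum (EuclideanSpace.basisFun (Fin n) ℝ),
    contr_eq_sum ((EuclideanSpace.basisFun (Fin n) ℝ).map g.1⁻¹)]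
  simp only [repTors_apply, LinearIsometryEquiv.inner_map_map, OrthonormalBasis.map_apply]

/-! ### The invariant cubic form -/

/-- The equivariant map `(v, α, β) ↦ (Y ↦ Z ↦ β_{α_v Y} Z + β_{α_Z v} Y)`. -/
def psi (v : Eu n) : Tors n →ₗ[ℝ] Tors n →ₗ[ℝ] Tors n :=
  LinearMap.mk₂ ℝ (fun α β => β ∘ₗ α v + (β ∘ₗ α.flip v).flip)
    (fun α α' β => by ext : 2; simp; abel)
    (fun c α β => by ext : 2; simp)
    (fun α β β' => by ext : 2; simp; abel)
    (fun c α β => by ext : 2; simp)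

@[simp] lemma psi_apply (v : Eu n) (α β : Tors n) (y z : Eu n) :
    psi v α β y z = β (α v y) z + β (α z v) y := rfl

lemma psi_add (v v' : Eu n) : psi (v + v') = psi v + psi v' := by
  ext : 4
  simp
  abel

lemma psi_smul (c : ℝ) (v : Eu n) : psi (c • v) = c • psi v := by
  ext : 4
  simp

lemma psi_repTors {G : Subgroup (On n)} (g : G) (v : Eu n) (α β : Tors n) :
    psi (g.1 v) (repTors G g α) (repTors G g β) = repTors G g (psi v α β) := by
  have h : ∀ x, g.1⁻¹ (g.1 x) = x := g.1.symm_apply_apply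
  ext : 2
  simp [repTors_apply, h]

section CubicForm

variable {G : Subgroup (On n)} {W : Type*} [AddCommGroup W] [Module ℝ W]
  (σ : Representation ℝ G W) (j : W →ₗ[ℝ] Tors n)

/-- The map `psi v` on the tensor square of `W`. -/
def psiTensor (v : Eu n) : W ⊗[ℝ] W →ₗ[ℝ] Tors n :=
  TensorProduct.lift ((psi v).compl₁₂ j j)

@[simp] lemma psiTensor_tmul (v : Eu n) (α β : W) :
    psiTensor j v (α ⊗ₜ β) = psi v (j α) (j β) := rfl

lemma psiTensor_add (v v' : Eu n) : psiTensor j (v + v') = psiTensor j v + psiTensor j v' := by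
  refine TensorProduct.ext' fun α β => ?_
  simp only [psiTensor_tmul, psi_add, LinearMap.add_apply]

lemma psiTensor_smul (c : ℝ) (v : Eu n) : psiTensor j (c • v) = c • psiTensor j v := by
  refine TensorProduct.ext' fun α β => ?_
  simp only [psiTensor_tmul, psi_smul, LinearMap.smul_apply]

/-- The linear form `v ⊗ η ⊗ (α ⊙ β) ↦ ⟨η, psi v α β⟩` on `V ⊗ W ⊗ S²W`. -/
def cubicForm : Eu n ⊗[ℝ] (W ⊗[ℝ] (symSq σ).toSubmodule) →ₗ[ℝ] ℝ :=
  TensorProduct.lift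
    { toFun := fun v => TensorProduct.lift
        { toFun := fun η => contr (j η) ∘ₗ psiTensor j v ∘ₗ Submodule.subtype _
          map_add' := fun η η' => LinearMap.ext fun t => by simp
          map_smul' := fun c η => LinearMap.ext fun t => by simp }
      map_add' := fun v v' => TensorProduct.ext' fun η t => by
        simp [psiTensor_add]
      map_smul' := fun c v => TensorProduct.ext' fun η t => by
        simp [psiTensor_smul] }

lemma cubicForm_tmul (v : Eu n) (η : W) (t : (symSq σ).toSubmodule) :
    cubicForm σ j (v ⊗ₜ (η ⊗ₜ t)) = contr (j η) (psiTensor j v t.1) := rfl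

variable {σ j}

lemma psiTensor_equivariant (hj : ∀ g w, j (σ g w) = repTors G g (j w)) (g : G) (v : Eu n)
    (t : W ⊗[ℝ] W) : psiTensor j (g.1 v) ((σ.tprod σ) g t) = repTors G g (psiTensor j v t) := by
  induction t with
  | zero => simp
  | tmul α β =>
    rw [Representation.tprod_apply, TensorProduct.map_tmul, psiTensor_tmul, psiTensor_tmul, hj, hj,
      psi_repTors]
  | add s t hs ht => simp only [map_add, hs, ht]

lemma cubicForm_invariant (hj : ∀ g w, j (σ g w) = repTors G g (j w)) (g : G)
    (x : Eu n ⊗[ℝ] (W ⊗[ℝ] (symSq σ).toSubmodule)) :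
    cubicForm σ j ((repV G).tprod (σ.tprod (symSq σ).toRepresentation) g x) = cubicForm σ j x := by
  refine apply_tprod_tprod_of_tmul (fun g v η t => ?_) g x
  rw [cubicForm_tmul, cubicForm_tmul, hj, ← contr_repTors g (j η), ← psiTensor_equivariant hj]
  rfl

/-- The inner product induced from `V ⊗ End V` by an injective map. -/
@[reducible] def torsCore (hinj : Function.Injective j) : InnerProductSpace.Core ℝ W where
  inner α β := contr (j α) (j β)
  conj_inner_symm α β := by simp [contr_comm (j α) (j β)]
  re_inner_nonneg α := contr_self_nonneg (j α)
  add_left α β γ := by simp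
  smul_left α β c := by simp
  definite α h := (map_eq_zero_iff j hinj).1 (eq_zero_of_contr_self_eq_zero h)

/-- The inner product pulled back along `j` makes `σ` orthogonal, so an invariant form must vanish.
-/
lemma cubicForm_eq_zero (hinj : Function.Injective j)
    (hj : ∀ g w, j (σ g w) = repTors G g (j w))
    (hinv : ((repV G).tprod (σ.tprod (symSq σ).toRepresentation)).invariants = ⊥) :
    cubicForm σ j = 0 := by
  have : FiniteDimensional ℝ W := FiniteDimensional.of_injective j hinj
  let _ : NormedAddCommGroup W := (torsCore hinj).toNormedAddCommGroup
  let _ : InnerProductSpace ℝ W := .ofCore (torsCore hinj).toCore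
  have hV : IsOrthogonalRep (repV G) := fun g x y => g.1.inner_map_map x y
  have hW : IsOrthogonalRep σ := fun g x y => by
    change contr (j _) (j _) = contr (j x) (j y)
    rw [hj, hj, contr_repTors]
  exact IsOrthogonalRep.tprod_tprod_symSq hV hW hinv (cubicForm_invariant hj)

/-- The expression is quadratic in `α`, and `α ⊗ α` is symmetric; hence `S²W` suffices in place of
`W ⊗ W`. -/
lemma contr_psi_self_eq_zero_of_addCommGroup (hinj : Function.Injective j)
    (hj : ∀ g w, j (σ g w) = repTors G g (j w))
    (hinv : ((repV G).tprod (σ.tprod (symSq σ).toRepresentation)).invariants = ⊥) (v : Eu n)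
    (η α : W) : contr (j η) (psi v (j α) (j α)) = 0 := by
  have hmem : α ⊗ₜ[ℝ] α ∈ (symSq σ).toSubmodule := by
    change TensorProduct.comm ℝ _ _ _ = _
    simp
  have h := cubicForm_tmul σ j v η ⟨α ⊗ₜ α, hmem⟩
  rw [cubicForm_eq_zero hinj hj hinv, LinearMap.zero_apply] at h
  rw [h, psiTensor_tmul]

end CubicForm

lemma contr_psi_self_eq_zero {G : Subgroup (On n)} {W : Type*} [AddCommMonoid W] [Module ℝ W]
    {σ : Representation ℝ G W} {j : W →ₗ[ℝ] Tors n} (hinj : Function.Injective j)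
    (hj : ∀ g w, j (σ g w) = repTors G g (j w))
    (hinv : ((repV G).tprod (σ.tprod (symSq σ).toRepresentation)).invariants = ⊥) (v : Eu n)
    (η α : W) : contr (j η) (psi v (j α) (j α)) = 0 := by
  -- This group structure extends the given monoid, so `hinv` still concerns the same tensor
  -- products.
  let _ : AddCommGroup W := Module.addCommMonoidToAddCommGroup ℝ
  exact contr_psi_self_eq_zero_of_addCommGroup hinj hj hinv v η α

/-- If `V ⊗ W ⊗ S²W` has no invariants, the cubic form vanishes on `V ⊗ W ⊗ S²W`. -/
lemma contr_psi_eq_zero {G : Subgroup (On n)} {W : Subrepresentation (repTors G)}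
    (hinv : (repVWSW G W).invariants = ⊥) (v : Eu n) {η α : Tors n} (hη : η ∈ W.toSubmodule)
    (hα : α ∈ W.toSubmodule) : contr η (psi v α α) = 0 :=
  contr_psi_self_eq_zero (σ := W.toRepresentation) (j := W.toSubmodule.subtype)
    (Submodule.subtype_injective _) (fun _ _ => rfl) hinv v ⟨η, hη⟩ ⟨α, hα⟩

/-! ### Contractions of tensors with four indices -/

section FourIndices

variable {ι : Type*} [Fintype ι]

/-- The sum over four indices. -/
def sum4 (f : ι → ι → ι → ι → ℝ) : ℝ := ∑ i, ∑ j, ∑ k, ∑ l, f i j k l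

lemma sum4_add (f g : ι → ι → ι → ι → ℝ) :
    sum4 (fun i j k l => f i j k l + g i j k l) = sum4 f + sum4 g := by
  simp only [sum4, Finset.sum_add_distrib]

lemma sum4_const_mul (c : ℝ) (f : ι → ι → ι → ι → ℝ) :
    sum4 (fun i j k l => c * f i j k l) = c * sum4 f := by
  simp only [sum4, Finset.mul_sum]

lemma sum4_swap_first (f : ι → ι → ι → ι → ℝ) : sum4 f = sum4 (fun i j k l => f j i k l) :=
  Finset.sum_comm

lemma sum4_swap_middle (f : ι → ι → ι → ι → ℝ) : sum4 f = sum4 (fun i j k l => f i k j l) :=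
  Finset.sum_congr rfl fun _ _ => Finset.sum_comm

lemma sum4_swap_last (f : ι → ι → ι → ι → ℝ) : sum4 f = sum4 (fun i j k l => f i j l k) :=
  Finset.sum_congr rfl fun _ _ => Finset.sum_congr rfl fun _ _ => Finset.sum_comm

lemma sum4_rotate (f : ι → ι → ι → ι → ℝ) : sum4 f = sum4 (fun i j k l => f j k i l) := by
  rw [sum4_swap_middle f, sum4_swap_first]

lemma eq_zero_of_sum4_sq_eq_zero {f : ι → ι → ι → ι → ℝ}
    (h : sum4 (fun i j k l => f i j k l ^ 2) = 0) (i j k l : ι) : f i j k l = 0 := by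
  have h0 : ∀ i j k l, 0 ≤ f i j k l ^ 2 := fun _ _ _ _ => sq_nonneg _
  have h1 := (Finset.sum_eq_zero_iff_of_nonneg (fun i _ => Finset.sum_nonneg fun j _ =>
    Finset.sum_nonneg fun k _ => Finset.sum_nonneg fun l _ => h0 i j k l)).1 h i (Finset.mem_univ i)
  have h2 := (Finset.sum_eq_zero_iff_of_nonneg (fun j _ =>
    Finset.sum_nonneg fun k _ => Finset.sum_nonneg fun l _ => h0 i j k l)).1 h1 j
      (Finset.mem_univ j)
  have h3 := (Finset.sum_eq_zero_iff_of_nonneg (fun k _ =>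
    Finset.sum_nonneg fun l _ => h0 i j k l)).1 h2 k (Finset.mem_univ k)
  have h4 := (Finset.sum_eq_zero_iff_of_nonneg (fun l _ => h0 i j k l)).1 h3 l (Finset.mem_univ l)
  exact pow_eq_zero_iff two_ne_zero |>.1 h4

/-- A tensor `φ ∈ V ⊗ Λ³` is zero if it satisfies the first Bianchi identity with a curvature
`R ∈ Λ² ⊗ 𝔤` and quadratic terms `N`, is orthogonal to `𝔤` in its last two indices, and pairs to
zero with `N`. -/
lemma eq_zero_of_bianchi {R φ N : ι → ι → ι → ι → ℝ}
    (hR : ∀ i j k l, R i j k l = -R i j l k)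
    (hφ₁ : ∀ i j k l, φ i j k l = -φ i k j l) (hφ₂ : ∀ i j k l, φ i j k l = -φ i j l k)
    (hN : ∀ i j k l, N i j k l = -N i j l k)
    (hbianchi : ∀ i j k l, R i j k l + R j k i l + R k i j l =
      -2 * (φ i j k l + φ j k i l + φ k i j l) + 4 * (N i j k l + N j k i l + N k i j l))
    (hperp : ∀ i j p q, ∑ k, ∑ l, R i j k l * φ p q k l = 0)
    (hcubic : sum4 (fun i j k l => φ i j k l * (N i j k l + N k i j l)) = 0) (i j k l : ι) :
    φ i j k l = 0 := by
  set r := sum4 (fun i j k l => R j k i l * φ i j k l) with hr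
  set q := sum4 (fun i j k l => φ j i k l * φ i j k l) with hq
  set s := sum4 (fun i j k l => φ i j k l * φ i j k l) with hs
  set a := sum4 (fun i j k l => N i j k l * φ i j k l) with ha
  set b := sum4 (fun i j k l => N j k i l * φ i j k l) with hb
  set c := sum4 (fun i j k l => N k i j l * φ i j k l) with hc
  -- contraction with `φ i j k l`
  have r1 : sum4 (fun i j k l => R i j k l * φ i j k l) = 0 := by
    simp only [sum4, hperp, Finset.sum_const_zero]
  have r3 : sum4 (fun i j k l => R k i j l * φ i j k l) = 0 := by
    have : (fun i j k l => R k i j l * φ i j k l) = fun i j k l => (-1) * (R k i j l * φ i k j l) := by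
      ext i j k l
      rw [hφ₁ i j k l]; ring
    rw [this, sum4_const_mul, sum4_swap_middle]
    have : sum4 (fun i j k l => R j i k l * φ i j k l) = 0 := by
      simp only [sum4, hperp, Finset.sum_const_zero]
    rw [this, mul_zero]
  have q2 : sum4 (fun i j k l => φ j k i l * φ i j k l) = -q := by
    rw [← neg_one_mul, hq, ← sum4_const_mul]
    congr 1; ext i j k l
    rw [hφ₁ j k i l]; ring
  have q3 : sum4 (fun i j k l => φ k i j l * φ i j k l) = -q := by
    rw [← neg_one_mul, hq, ← sum4_const_mul, sum4_swap_middle]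
    congr 1; ext i j k l
    rw [hφ₁ i k j l]; ring
  -- Orthogonality to `𝔤` kills two of the three curvature terms; only `r` survives.
  have first : r = -2 * s + 4 * q + 4 * (a + b + c) := by
    have e : sum4 (fun i j k l => (R i j k l + R j k i l + R k i j l) * φ i j k l) =
        sum4 (fun i j k l => (-2 * (φ i j k l + φ j k i l + φ k i j l) +
          4 * (N i j k l + N j k i l + N k i j l)) * φ i j k l) := by
      congr 1; ext i j k l; rw [hbianchi]
    simp only [add_mul, mul_add, sum4_add, mul_assoc, sum4_const_mul] at e
    rw [r1, r3, q2, q3] at e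
    linarith
  -- contraction with `φ l i j k`
  have hcyc : ∀ i j k l, φ l i j k = φ l j k i := fun i j k l => by
    rw [hφ₁ l i j k, hφ₂ l j i k, neg_neg]
  have key : ∀ T : ι → ι → ι → ι → ℝ, sum4 (fun i j k l => (T i j k l + T j k i l + T k i j l) *
      φ l i j k) = 3 * sum4 (fun i j k l => T i j k l * φ l i j k) := fun T => by
    have t2 : sum4 (fun i j k l => T j k i l * φ l i j k) =
        sum4 (fun i j k l => T i j k l * φ l i j k) := by
      rw [sum4_rotate (fun i j k l => T i j k l * φ l i j k)]
      congr 1; ext i j k l; rw [hcyc i j k l]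
    have t3 : sum4 (fun i j k l => T k i j l * φ l i j k) =
        sum4 (fun i j k l => T i j k l * φ l i j k) := by
      rw [sum4_rotate]
      congr 1; ext i j k l; rw [hcyc i j k l]
    simp only [add_mul, sum4_add, t2, t3]
    ring
  -- moving the last index to the front
  have move : ∀ T : ι → ι → ι → ι → ℝ, sum4 (fun i j k l => T i j k l * φ l i j k) =
      sum4 (fun i j k l => T j k l i * φ i j k l) := fun T => by
    rw [sum4_swap_last, sum4_swap_middle, sum4_swap_first]
  have m1 : sum4 (fun i j k l => R i j k l * φ l i j k) = -r := by
    rw [move, ← neg_one_mul, hr, ← sum4_const_mul]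
    congr 1; ext i j k l; rw [hR j k l i]; ring
  have m2 : sum4 (fun i j k l => N i j k l * φ l i j k) = -b := by
    rw [move, ← neg_one_mul, hb, ← sum4_const_mul]
    congr 1; ext i j k l; rw [hN j k l i]; ring
  have m3 : sum4 (fun i j k l => φ i j k l * φ l i j k) = q := by
    rw [move, hq]
    congr 1; ext i j k l; rw [hcyc i k l j]
  -- `φ_{lijk}` is invariant under cycling `i, j, k`, so each cyclic sum contributes three equal
  -- terms.
  have second : -3 * r = -6 * q - 12 * b := by
    have e : sum4 (fun i j k l => (R i j k l + R j k i l + R k i j l) * φ l i j k) =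
        sum4 (fun i j k l => -2 * ((φ i j k l + φ j k i l + φ k i j l) * φ l i j k) +
          4 * ((N i j k l + N j k i l + N k i j l) * φ l i j k)) := by
      congr 1; ext i j k l; rw [hbianchi]; ring
    rw [sum4_add, sum4_const_mul, sum4_const_mul, key, key, key, m1, m2, m3] at e
    linarith
  -- `b` enters both relations with the same weight once `r` is eliminated, so only `a + c` has to
  -- vanish.
  have hac : a + c = 0 := by
    rw [ha, hc, ← sum4_add, ← hcubic]
    congr 1; ext i j k l; ring
  have hsq : s = q := by linarith
  -- The squared norm of the antisymmetrization of `φ` in its first two indices is `2s - 2q`.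
  have hsym : ∀ i j k l, φ i j k l - φ j i k l = 0 := by
    apply eq_zero_of_sum4_sq_eq_zero
    have e : sum4 (fun i j k l => (φ i j k l - φ j i k l) ^ 2) =
        s + (-2) * q + sum4 (fun i j k l => φ j i k l * φ j i k l) := by
      rw [hs, hq, ← sum4_const_mul, ← sum4_add, ← sum4_add]
      congr 1; ext i j k l; ring
    rw [e, ← sum4_swap_first (fun i j k l => φ i j k l * φ i j k l)]
    linarith
  -- Six alternating uses of symmetry in the first pair and skewness in the next turn `φ_{ijkl}`
  -- into its negative.
  have h1 := hsym i j k l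
  have h2 := hsym j k i l
  have h3 := hsym k i j l
  have h4 := hφ₁ i j k l
  have h5 := hφ₁ j i k l
  have h6 := hφ₁ k i j l
  linarith

end FourIndices

/-! ### The infinitesimal structure equations -/

/-- The bracket coefficients of a torsion-free connection with coefficients `γ`. -/
def bracketCoeff (γ : Tc n) (v w : Eu n) : Eu n := γ v w - γ w v

/-- The curvature of a connection with coefficients `a` and derivatives `da` of the coefficients,
in a frame with bracket coefficients `c`. -/
def curv (a : Tc n) (da : Eu n → Tc n) (c : Eu n → Eu n → Eu n) (u v : Eu n) : Eu n →L[ℝ] Eu n :=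
  da u v - da v u + (a u * a v - a v * a u) - a (c u v)

lemma curv_apply (a : Tc n) (da : Eu n → Tc n) (c : Eu n → Eu n → Eu n) (u v w : Eu n) :
    curv a da c u v w = da u v w - da v u w + (a u (a v w) - a v (a u w)) - a (c u v) w := rfl

/-- The first Bianchi identity for a connection with skew-symmetric torsion, in a frame. -/
lemma cyclic_curv_eq {a ξ : Tc n} {da dξ : Eu n → Tc n}
    (hξ : ∀ v w, ξ v w = -ξ w v) (hdξ : ∀ u v w, dξ u v w = -dξ u w v)
    (hjac : ∀ u v w,
      bracketCoeff (da u + dξ u) v w + bracketCoeff (a + ξ) u (bracketCoeff (a + ξ) v w) +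
      (bracketCoeff (da v + dξ v) w u + bracketCoeff (a + ξ) v (bracketCoeff (a + ξ) w u)) +
      (bracketCoeff (da w + dξ w) u v + bracketCoeff (a + ξ) w (bracketCoeff (a + ξ) u v)) = 0)
    (u v w : Eu n) :
    curv a da (bracketCoeff (a + ξ)) u v w + curv a da (bracketCoeff (a + ξ)) v w u +
        curv a da (bracketCoeff (a + ξ)) w u v =
      (-2 : ℝ) • ((dξ u + derivAct (a u) ξ) v w + (dξ v + derivAct (a v) ξ) w u +
        (dξ w + derivAct (a w) ξ) u v) +
      (4 : ℝ) • (ξ (ξ u v) w + ξ (ξ v w) u + ξ (ξ w u) v) := by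
  have h := hjac u v w
  -- Turning every `ξ` into cyclic order makes the claim a linear rearrangement of Jacobi. The
  -- torsion `-2ξ` enters once in the derivative terms and twice in the quadratic ones, whence `-2`
  -- and `4`.
  simp only [bracketCoeff, curv_apply, add_apply, map_add, map_sub, sub_apply, derivAct_apply,
    hξ w v, hξ v u, hξ u w, hdξ u w v, hdξ v u w, hdξ w v u, map_neg, neg_apply,
    hξ u (a v w), hξ v (a w u), hξ w (a u v), hξ u (a w v), hξ v (a u w), hξ w (a v u),
    hξ u (ξ v w), hξ v (ξ w u), hξ w (ξ u v)] at h ⊢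
  linear_combination (norm := module) h

/-- The algebraic heart: a derivative of the torsion compatible with the Bianchi identity vanishes
if it is orthogonal to the quadratic terms. -/
lemma eq_zero_of_cyclic {G : Subgroup (On n)} {φ : Eu n →ₗ[ℝ] Tc n} {ξ : Tc n}
    {Ω : Eu n → Eu n → Eu n →L[ℝ] Eu n}
    (hξ : ∀ v w z, inner ℝ (ξ v w) z = -inner ℝ (ξ v z) w)
    (hφ₁ : ∀ u v w, φ u v w = -φ u w v)
    (hφ₂ : ∀ u v w z, inner ℝ (φ u v w) z = -inner ℝ (φ u v z) w)
    (hφG : ∀ u, toTors (φ u) ∈ VPerp G) (hΩ : ∀ u v, Ω u v ∈ lieAlgC G)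
    (hbianchi : ∀ u v w, Ω u v w + Ω v w u + Ω w u v =
      (-2 : ℝ) • (φ u v w + φ v w u + φ w u v) + (4 : ℝ) • (ξ (ξ u v) w + ξ (ξ v w) u + ξ (ξ w u) v))
    (hcubic : ∀ u, contr (toTors (φ u)) (psi u (toTors ξ) (toTors ξ)) = 0) :
    φ = 0 := by
  set b := EuclideanSpace.basisFun (Fin n) ℝ with hb
  have parseval : ∀ x y : Eu n, ∑ l, inner ℝ x (b l) * inner ℝ y (b l) = inner ℝ x y := fun x y => by
    rw [← b.sum_inner_mul_inner]
    simp only [real_inner_comm]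
  suffices h : ∀ i j k l, inner ℝ (φ (b i) (b j) (b k)) (b l) = 0 by
    refine b.toBasis.ext fun i => ?_
    refine ContinuousLinearMap.coe_injective (b.toBasis.ext fun j => ?_)
    refine ContinuousLinearMap.coe_injective (b.toBasis.ext fun k => ?_)
    refine InnerProductSpace.ext_inner_right_basis b.toBasis fun l => ?_
    simpa using h i j k l
  intro i j k l
  refine eq_zero_of_bianchi (R := fun i j k l => inner ℝ (Ω (b i) (b j) (b k)) (b l))
    (φ := fun i j k l => inner ℝ (φ (b i) (b j) (b k)) (b l))
    (N := fun i j k l => inner ℝ (ξ (ξ (b i) (b j)) (b k)) (b l)) ?_ ?_ ?_ ?_ ?_ ?_ ?_ i j k l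
  · intro i j k l
    rw [inner_apply_of_mem_lieAlgC (hΩ _ _), real_inner_comm]
  · intro i j k l
    rw [hφ₁, inner_neg_left]
  · intro i j k l
    exact hφ₂ _ _ _ _
  · intro i j k l
    exact hξ _ _ _
  · intro i j k l
    have := congrArg (fun x => inner ℝ x (b l)) (hbianchi (b i) (b j) (b k))
    simpa only [inner_add_left, real_inner_smul_left] using this
  -- By Parseval and skewness of `Ω` the double sum is `-tr(Ω φ)`, which vanishes as `φ` takes
  -- values in `𝔤^⊥`.
  · intro i j p q
    have h := (hφG (b p) (b q)).2 _ (mem_lieAlgC_iff.1 (hΩ (b i) (b j)))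
    rw [LinearMap.trace_eq_sum_inner _ b] at h
    simp only [parseval]
    rw [← h, ← Finset.sum_neg_distrib]
    exact Finset.sum_congr rfl fun k _ => inner_apply_of_mem_lieAlgC (hΩ _ _) _ _
  -- Parseval in the last index identifies the sum with the pairing of `φ_u` and `psi u ξ ξ`, summed
  -- over basis vectors `u`.
  · rw [sum4]
    refine Finset.sum_eq_zero fun i _ => ?_
    rw [← hcubic (b i), contr_apply]
    refine Finset.sum_congr rfl fun j _ => Finset.sum_congr rfl fun k _ => ?_
    simp only [← inner_add_left, parseval]
    rfl

/-! ### Moving frames -/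

section Frames

variable {M : Type*} [TopologicalSpace M] [ChartedSpace (Eu n) M]

/-- The standard basis of `ℝⁿ`. -/
abbrev stdBasis (n : ℕ) : OrthonormalBasis (Fin n) ℝ (Eu n) := EuclideanSpace.basisFun (Fin n) ℝ

lemma mdifferentiableAt_of_coords {f : M → Eu n} {x : M}
    (h : ∀ i, MDifferentiableAt (𝓡 n) 𝓘(ℝ) (fun y => inner ℝ (stdBasis n i) (f y)) x) :
    MDifferentiableAt (𝓡 n) 𝓘(ℝ, Eu n) f x := by
  have e : f = ∑ i, fun y => inner ℝ (stdBasis n i) (f y) • stdBasis n i := by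
    ext1 y
    rw [Finset.sum_apply]
    exact ((stdBasis n).sum_repr' (f y)).symm
  rw [e]
  exact MDifferentiableAt.sum fun i _ => (h i).smul mdifferentiableAt_const

lemma mdifferentiableAt_clm_comp {E F : Type*} [NormedAddCommGroup E] [NormedSpace ℝ E]
    [NormedAddCommGroup F] [NormedSpace ℝ F] (L : E →L[ℝ] F) {f : M → E} {x : M}
    (h : MDifferentiableAt (𝓡 n) 𝓘(ℝ, E) f x) :
    MDifferentiableAt (𝓡 n) 𝓘(ℝ, F) (fun y => L (f y)) x :=
  L.mdifferentiableAt.comp x h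

lemma mdifferentiableAt_coord {f : M → Eu n} {x : M}
    (h : MDifferentiableAt (𝓡 n) 𝓘(ℝ, Eu n) f x) (v : Eu n) :
    MDifferentiableAt (𝓡 n) 𝓘(ℝ) (fun y => inner ℝ v (f y)) x :=
  mdifferentiableAt_clm_comp (innerSL ℝ v) h

lemma mvfderiv_clm_comp {E F : Type*} [NormedAddCommGroup E] [NormedSpace ℝ E]
    [NormedAddCommGroup F] [NormedSpace ℝ F] (L : E →L[ℝ] F) {f : M → E} {x : M}
    (h : MDifferentiableAt (𝓡 n) 𝓘(ℝ, E) f x) (X : TangentSpace (𝓡 n) x) :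
    mvfderiv (𝓡 n) (fun y => L (f y)) x X = L (mvfderiv (𝓡 n) f x X) := by
  have h1 : HasMFDerivAt (𝓡 n) 𝓘(ℝ, F) (L ∘ f) x (L.comp (mfderiv (𝓡 n) 𝓘(ℝ, E) f x)) :=
    L.hasMFDerivAt.comp x h.hasMFDerivAt
  exact congrArg (fun T => T X) h1.mfderiv

variable [IsManifold (𝓡 n) ∞ M]

lemma mvfderiv_clm_apply {E F : Type*} [NormedAddCommGroup E] [NormedSpace ℝ E]
    [NormedAddCommGroup F] [NormedSpace ℝ F] {g : M → E →L[ℝ] F} {f : M → E} {x : M}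
    (hg : MDifferentiableAt (𝓡 n) 𝓘(ℝ, E →L[ℝ] F) g x)
    (hf : MDifferentiableAt (𝓡 n) 𝓘(ℝ, E) f x) (X : TangentSpace (𝓡 n) x) :
    mvfderiv (𝓡 n) (fun y => g y (f y)) x X =
      mvfderiv (𝓡 n) g x X (f x) + g x (mvfderiv (𝓡 n) f x X) := by
  have h : HasFDerivWithinAt (writtenInExtChartAt (𝓡 n) 𝓘(ℝ, F) x fun y => g y (f y)) _ _ _ :=
    hg.hasMFDerivAt.2.clm_apply hf.hasMFDerivAt.2
  have h1 : HasMFDerivAt (𝓡 n) 𝓘(ℝ, F) (fun y => g y (f y)) x _ :=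
    ⟨hg.continuousAt.clm_apply hf.continuousAt, h⟩
  have h2 := congrArg (fun T => T X) h1.mfderiv
  refine Eq.trans h2 ?_
  simp only [writtenInExtChartAt, Function.comp_apply, extChartAt_to_inv]
  exact add_comm _ _

/-- The vector field `Y` is differentiable at `x`. -/
abbrev SecDiffAt (Y : ∀ y : M, TangentSpace (𝓡 n) y) (x : M) : Prop :=
  MDifferentiableAt (𝓡 n) ((𝓡 n).prod 𝓘(ℝ, Eu n)) (fun y => (⟨y, Y y⟩ : TangentBundle (𝓡 n) M)) x

lemma covariantDerivative_sum (D : Conn (n := n) M) {ι : Type*} (t : Finset ι)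
    {σ : ι → ∀ y : M, TangentSpace (𝓡 n) y} {x : M} (h : ∀ i ∈ t, SecDiffAt (σ i) x) :
    D (fun y => ∑ i ∈ t, σ i y) x = ∑ i ∈ t, D (σ i) x := by
  classical
  induction t using Finset.induction_on with
  | empty =>
    simp only [Finset.sum_empty]
    exact congrFun D.zero x
  | insert i t hi ih =>
    simp only [Finset.mem_insert, forall_eq_or_imp] at h
    rw [Finset.sum_insert hi, ← ih h.2]
    simp only [Finset.sum_insert hi]
    exact D.isCovariantDerivativeOnUniv.add h.1 (MDifferentiableAt.sum_section h.2)

variable [RiemannianBundle (fun x : M => TangentSpace (𝓡 n) x)]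

/-- `s` is a smooth orthonormal frame field over the open set `U`. -/
structure IsSmoothFrame (U : Set M) (s : ∀ y : M, Eu n ≃ₗᵢ[ℝ] TangentSpace (𝓡 n) y) : Prop where
  isOpen : IsOpen U
  smooth : ∀ v : Eu n, ContMDiffOn (𝓡 n) ((𝓡 n).prod 𝓘(ℝ, Eu n)) ∞
    (fun y => (⟨y, s y v⟩ : TangentBundle (𝓡 n) M)) U

variable {U : Set M} {s : ∀ y : M, Eu n ≃ₗᵢ[ℝ] TangentSpace (𝓡 n) y} {x : M}

namespace IsSmoothFrame

lemma contMDiffAt (hs : IsSmoothFrame U s) (hx : x ∈ U) (v : Eu n) :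
    ContMDiffAt (𝓡 n) ((𝓡 n).prod 𝓘(ℝ, Eu n)) ∞
      (fun y => (⟨y, s y v⟩ : TangentBundle (𝓡 n) M)) x :=
  (hs.smooth v).contMDiffAt (hs.isOpen.mem_nhds hx)

lemma mdifferentiableAt (hs : IsSmoothFrame U s) (hx : x ∈ U) (v : Eu n) :
    SecDiffAt (fun y => s y v) x :=
  (hs.contMDiffAt hx v).mdifferentiableAt (by simp)

lemma eq_sum (s : ∀ y : M, Eu n ≃ₗᵢ[ℝ] TangentSpace (𝓡 n) y) (f : M → Eu n) (y : M) :
    s y (f y) = ∑ i, inner ℝ (stdBasis n i) (f y) • s y (stdBasis n i) := by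
  conv_lhs => rw [← (stdBasis n).sum_repr' (f y)]
  simp only [map_sum, map_smul]

lemma mdifferentiableAt_apply (hs : IsSmoothFrame U s) (hx : x ∈ U) {f : M → Eu n}
    (hf : MDifferentiableAt (𝓡 n) 𝓘(ℝ, Eu n) f x) : SecDiffAt (fun y => s y (f y)) x := by
  simp only [eq_sum s f]
  exact MDifferentiableAt.sum_section fun i _ =>
    (mdifferentiableAt_coord hf _).smul_section (hs.mdifferentiableAt hx _)

/-- Since the frame is orthonormal, the coordinates of `Y` are its inner products with the frame
fields, and the metric is smooth. -/
lemma mdifferentiableAt_symm_apply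
    [IsContMDiffRiemannianBundle (𝓡 n) ∞ (Eu n) (fun x : M => TangentSpace (𝓡 n) x)]
    (hs : IsSmoothFrame U s) (hx : x ∈ U)
    {Y : ∀ y : M, TangentSpace (𝓡 n) y} (hY : SecDiffAt Y x) :
    MDifferentiableAt (𝓡 n) 𝓘(ℝ, Eu n) (fun y => (s y).symm (Y y)) x := by
  refine mdifferentiableAt_of_coords fun i => ?_
  have h := (hs.mdifferentiableAt hx (stdBasis n i)).inner_bundle hY
  convert h using 2 with y
  rw [← (s y).inner_map_map, (s y).apply_symm_apply]

/-- The covariant derivative in a frame, before introducing connection coefficients. -/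
lemma cov_apply_eq_sum (hs : IsSmoothFrame U s) (hx : x ∈ U) (D : Conn (n := n) M) {f : M → Eu n}
    (hf : MDifferentiableAt (𝓡 n) 𝓘(ℝ, Eu n) f x) (X : TangentSpace (𝓡 n) x) :
    D (fun y => s y (f y)) x X = s x (mvfderiv (𝓡 n) f x X) +
      ∑ i, inner ℝ (stdBasis n i) (f x) • D (fun y => s y (stdBasis n i)) x X := by
  have hc := fun i => mdifferentiableAt_coord hf (stdBasis n i)
  simp only [eq_sum s f]
  rw [covariantDerivative_sum D _
    (σ := fun i y => inner ℝ (stdBasis n i) (f y) • s y (stdBasis n i)) (fun i _ =>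
    (hc i).smul_section (hs.mdifferentiableAt hx _))]
  have h1 : ∀ i, D (fun y => inner ℝ (stdBasis n i) (f y) • s y (stdBasis n i)) x =
      inner ℝ (stdBasis n i) (f x) • D (fun y => s y (stdBasis n i)) x +
      (mvfderiv (𝓡 n) (fun y => inner ℝ (stdBasis n i) (f y)) x).smulRight (s x (stdBasis n i)) := fun i =>
    D.isCovariantDerivativeOnUniv.leibniz (hs.mdifferentiableAt hx _) (hc i)
  simp only [h1, Finset.sum_add_distrib, add_apply, sum_apply]
  rw [add_comm]
  congr 1
  rw [eq_sum s (fun _ => mvfderiv (𝓡 n) f x X) x]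
  refine Finset.sum_congr rfl fun i _ => ?_
  rw [ContinuousLinearMap.smulRight_apply]
  congr 1
  exact mvfderiv_clm_comp (innerSL ℝ (stdBasis n i)) hf X

end IsSmoothFrame

/-- The coefficients of the connection `D` in the frame `s`:
`D_{s v} (s w) = s (connCoeff v w)`. -/
def connCoeff (D : Conn (n := n) M) (s : ∀ y : M, Eu n ≃ₗᵢ[ℝ] TangentSpace (𝓡 n) y) (y : M) :
    Tc n :=
  ∑ i, ∑ j, (innerSL ℝ (stdBasis n i)).smulRight ((innerSL ℝ (stdBasis n j)).smulRight
    ((s y).symm (D (fun z => s z (stdBasis n j)) y (s y (stdBasis n i)))))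

namespace IsSmoothFrame

/-- Only linearity of `D` in the direction is used, so no differentiability of the frame is needed.
Collapsing the sum over `j` as well would need the Leibniz rule. -/
lemma connCoeff_apply_eq_sum (D : Conn (n := n) M)
    (s : ∀ y : M, Eu n ≃ₗᵢ[ℝ] TangentSpace (𝓡 n) y) (y : M) (v w : Eu n) :
    s y (connCoeff D s y v w) = ∑ j, inner ℝ (stdBasis n j) w •
      D (fun z => s z (stdBasis n j)) y (s y v) := by
  have h : connCoeff D s y v w = ∑ i, ∑ j, inner ℝ (stdBasis n i) v • inner ℝ (stdBasis n j) w •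
    ((s y).symm (D (fun z => s z (stdBasis n j)) y (s y (stdBasis n i)))) := by
    simp only [connCoeff, sum_apply]
    rfl
  rw [h, Finset.sum_comm, map_sum]
  refine Finset.sum_congr rfl fun j _ => ?_
  rw [eq_sum s (fun _ => v) y]
  simp only [map_sum, map_smul, LinearIsometryEquiv.apply_symm_apply, Finset.smul_sum]
  exact Finset.sum_congr rfl fun i _ => smul_comm _ _ _

/-- The covariant derivative in a frame. -/
lemma cov_apply (hs : IsSmoothFrame U s) (hx : x ∈ U) (D : Conn (n := n) M) {f : M → Eu n}
    (hf : MDifferentiableAt (𝓡 n) 𝓘(ℝ, Eu n) f x) (v : Eu n) :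
    D (fun y => s y (f y)) x (s x v) = s x (mvfderiv (𝓡 n) f x (s x v) + connCoeff D s x v (f x)) := by
  rw [hs.cov_apply_eq_sum hx D hf, map_add, connCoeff_apply_eq_sum]

lemma cov_frame (hs : IsSmoothFrame U s) (hx : x ∈ U) (D : Conn (n := n) M) (v w : Eu n) :
    D (fun y => s y w) x (s x v) = s x (connCoeff D s x v w) := by
  have h := hs.cov_apply hx D (f := fun _ => w) mdifferentiableAt_const v
  rwa [mvfderiv_const, zero_apply, zero_add] at h

lemma mdifferentiableAt_cov [T2Space M] (hs : IsSmoothFrame U s) (hx : x ∈ U) {D : Conn (n := n) M}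
    (hD : D.ContMDiffCovariantDerivative ∞) (v w : Eu n) :
    SecDiffAt (fun y => D (fun z => s z w) y (s y v)) x := by
  -- A bump function makes the local frame field globally smooth, as the smoothness of `D` is
  -- applied on all of `M`. Near `x` it equals `1`, and `D` is local.
  obtain ⟨χ, -, hχ⟩ := (SmoothBumpFunction.nhds_basis_tsupport (I := 𝓡 n) x).mem_iff.1
    (hs.isOpen.mem_nhds hx)
  have hσ : ContMDiff (𝓡 n) ((𝓡 n).prod 𝓘(ℝ, Eu n)) ∞
      (fun y => (⟨y, ((χ : M → ℝ) • fun z => s z w) y⟩ : TangentBundle (𝓡 n) M)) :=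
    ContMDiffOn.smul_section_of_tsupport χ.contMDiff.contMDiffOn hs.isOpen hχ (hs.smooth w)
  have h1 := (hD.contMDiff.contMDiff (hσ.contMDiffOn (s := Set.univ))).contMDiffAt
    (x := x) Filter.univ_mem
  have h2 := (h1.clm_bundle_apply (hs.contMDiffAt hx v)).mdifferentiableAt (by simp)
  refine h2.congr_of_eventuallyEq ?_
  have h3 : ∀ᶠ y in 𝓝 x, y ∈ U ∧ ∀ᶠ z in 𝓝 y, χ z = 1 :=
    (hs.isOpen.eventually_mem hx).and χ.eventuallyEq_one.eventually_nhds
  filter_upwards [h3] with y hy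
  have h4 : D (fun z => s z w) y = D ((χ : M → ℝ) • fun z => s z w) y :=
    D.isCovariantDerivativeOnUniv.congr_of_eventuallyEq (hs.mdifferentiableAt hy.1 w)
      ((hσ y).mdifferentiableAt (by simp)) Filter.univ_mem
      (hy.2.mono fun z hz => by simp [hz])
  rw [h4]

lemma mdifferentiableAt_connCoeff [T2Space M]
    [IsContMDiffRiemannianBundle (𝓡 n) ∞ (Eu n) (fun x : M => TangentSpace (𝓡 n) x)]
    (hs : IsSmoothFrame U s) (hx : x ∈ U) {D : Conn (n := n) M}
    (hD : D.ContMDiffCovariantDerivative ∞) : MDifferentiableAt (𝓡 n) 𝓘(ℝ, Tc n) (connCoeff D s) x := by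
  let L : Fin n → Fin n → Eu n →L[ℝ] Tc n := fun i j =>
    ContinuousLinearMap.smulRightL ℝ (Eu n) (Eu n →L[ℝ] Eu n) (innerSL ℝ (stdBasis n i)) ∘L
      ContinuousLinearMap.smulRightL ℝ (Eu n) (Eu n) (innerSL ℝ (stdBasis n j))
  have e : connCoeff D s = ∑ i, ∑ j, fun y =>
      L i j ((s y).symm (D (fun z => s z (stdBasis n j)) y (s y (stdBasis n i)))) := by
    ext1 y
    simp only [Finset.sum_apply]
    rfl
  rw [e]
  refine MDifferentiableAt.sum fun i _ => MDifferentiableAt.sum fun j _ => ?_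
  have h := hs.mdifferentiableAt_symm_apply hx
    (hs.mdifferentiableAt_cov hx hD (stdBasis n i) (stdBasis n j))
  exact mdifferentiableAt_clm_comp (F := Tc n) (L i j) h

end IsSmoothFrame

end Frames

/-! ### Lie brackets of frame fields and the Jacobi identity. -/

section FrameEquations

variable {M : Type*} [TopologicalSpace M] [T2Space M] [ChartedSpace (Eu n) M]
  [IsManifold (𝓡 n) ∞ M] [RiemannianBundle (fun x : M => TangentSpace (𝓡 n) x)]
  [IsContMDiffRiemannianBundle (𝓡 n) ∞ (Eu n) (fun x : M => TangentSpace (𝓡 n) x)]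
  {U : Set M} {s : ∀ y : M, Eu n ≃ₗᵢ[ℝ] TangentSpace (𝓡 n) y} {x : M}

/-- The derivative of the connection coefficients in the frame direction `u`. -/
def connCoeffDeriv (D : Conn (n := n) M) (s : ∀ y : M, Eu n ≃ₗᵢ[ℝ] TangentSpace (𝓡 n) y) (x : M)
    (u : Eu n) : Tc n :=
  mvfderiv (𝓡 n) (connCoeff D s) x (s x u)

namespace IsSmoothFrame

/-- Vanishing torsion expresses the bracket as `D_X Y - D_Y X`. -/
lemma mlieBracket_apply (hs : IsSmoothFrame U s) (hx : x ∈ U) {D : Conn (n := n) M}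
    (hD : D.torsion = 0) {f h : M → Eu n} (hf : MDifferentiableAt (𝓡 n) 𝓘(ℝ, Eu n) f x)
    (hh : MDifferentiableAt (𝓡 n) 𝓘(ℝ, Eu n) h x) :
    VectorField.mlieBracket (𝓡 n) (fun y => s y (f y)) (fun y => s y (h y)) x =
      s x (mvfderiv (𝓡 n) h x (s x (f x)) - mvfderiv (𝓡 n) f x (s x (h x)) +
        bracketCoeff (connCoeff D s x) (f x) (h x)) := by
  rw [← D.torsion_eq_zero_iff.1 hD (hs.mdifferentiableAt_apply hx hf)
    (hs.mdifferentiableAt_apply hx hh), hs.cov_apply hx D hh, hs.cov_apply hx D hf, ← map_sub]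
  congr 1
  rw [bracketCoeff]
  abel

lemma mlieBracket_frame (hs : IsSmoothFrame U s) (hx : x ∈ U) {D : Conn (n := n) M}
    (hD : D.torsion = 0) (v w : Eu n) :
    VectorField.mlieBracket (𝓡 n) (fun y => s y v) (fun y => s y w) x =
      s x (bracketCoeff (connCoeff D s x) v w) := by
  have h := hs.mlieBracket_apply hx hD (f := fun _ => v) (h := fun _ => w)
    mdifferentiableAt_const mdifferentiableAt_const
  rw [h, mvfderiv_const, mvfderiv_const]
  simp

lemma mvfderiv_connCoeff_apply (hs : IsSmoothFrame U s) (hx : x ∈ U) {D : Conn (n := n) M}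
    (hD : D.ContMDiffCovariantDerivative ∞) (u v w : Eu n) :
    mvfderiv (𝓡 n) (fun y => connCoeff D s y v w) x (s x u) = connCoeffDeriv D s x u v w := by
  have h := hs.mdifferentiableAt_connCoeff hx hD
  exact mvfderiv_clm_comp (ContinuousLinearMap.apply ℝ (Eu n) w ∘L
    ContinuousLinearMap.apply ℝ (Eu n →L[ℝ] Eu n) v) h (s x u)

lemma mdifferentiableAt_connCoeff_apply (hs : IsSmoothFrame U s) (hx : x ∈ U)
    {D : Conn (n := n) M} (hD : D.ContMDiffCovariantDerivative ∞) (v w : Eu n) :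
    MDifferentiableAt (𝓡 n) 𝓘(ℝ, Eu n) (fun y => connCoeff D s y v w) x :=
  ((hs.mdifferentiableAt_connCoeff hx hD).clm_apply mdifferentiableAt_const).clm_apply
    mdifferentiableAt_const

lemma mvfderiv_bracketCoeff (hs : IsSmoothFrame U s) (hx : x ∈ U)
    {D : Conn (n := n) M} (hD : D.ContMDiffCovariantDerivative ∞) (u v w : Eu n) :
    mvfderiv (𝓡 n) (fun y => bracketCoeff (connCoeff D s y) v w) x (s x u) =
      bracketCoeff (connCoeffDeriv D s x u) v w := by
  have h := mvfderiv_fun_sub (hs.mdifferentiableAt_connCoeff_apply hx hD v w)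
    (hs.mdifferentiableAt_connCoeff_apply hx hD w v)
  simp only [bracketCoeff]
  rw [h, sub_apply, hs.mvfderiv_connCoeff_apply hx hD, hs.mvfderiv_connCoeff_apply hx hD]

lemma mlieBracket_mlieBracket_frame (hs : IsSmoothFrame U s) (hx : x ∈ U) {D : Conn (n := n) M}
    (hsmooth : D.ContMDiffCovariantDerivative ∞) (hD : D.torsion = 0) (u v w : Eu n) :
    VectorField.mlieBracket (𝓡 n) (fun y => s y u)
      (VectorField.mlieBracket (𝓡 n) (fun y => s y v) (fun y => s y w)) x =
      s x (bracketCoeff (connCoeffDeriv D s x u) v w +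
        bracketCoeff (connCoeff D s x) u (bracketCoeff (connCoeff D s x) v w)) := by
  have hc : MDifferentiableAt (𝓡 n) 𝓘(ℝ, Eu n) (fun y => bracketCoeff (connCoeff D s y) v w) x :=
    (hs.mdifferentiableAt_connCoeff_apply hx hsmooth v w).sub
      (hs.mdifferentiableAt_connCoeff_apply hx hsmooth w v)
  have e : VectorField.mlieBracket (𝓡 n) (fun y => s y v) (fun y => s y w) =ᶠ[𝓝 x]
      fun y => s y (bracketCoeff (connCoeff D s y) v w) :=
    (hs.isOpen.eventually_mem hx).mono fun y hy => hs.mlieBracket_frame hy hD v w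
  have h := hs.mlieBracket_apply hx hD (f := fun _ => u) mdifferentiableAt_const hc
  rw [mvfderiv_const, zero_apply, sub_zero, hs.mvfderiv_bracketCoeff hx hsmooth] at h
  exact (EventuallyEq.rfl.mlieBracket_vectorField_eq e).trans h

lemma jacobi (hs : IsSmoothFrame U s) (hx : x ∈ U) {D : Conn (n := n) M}
    (hsmooth : D.ContMDiffCovariantDerivative ∞) (hD : D.torsion = 0) (u v w : Eu n) :
    bracketCoeff (connCoeffDeriv D s x u) v w +
        bracketCoeff (connCoeff D s x) u (bracketCoeff (connCoeff D s x) v w) +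
      (bracketCoeff (connCoeffDeriv D s x v) w u +
        bracketCoeff (connCoeff D s x) v (bracketCoeff (connCoeff D s x) w u)) +
      (bracketCoeff (connCoeffDeriv D s x w) u v +
        bracketCoeff (connCoeff D s x) w (bracketCoeff (connCoeff D s x) u v)) = 0 := by
  have hsm : ∀ v, ContMDiffAt (𝓡 n) ((𝓡 n).prod 𝓘(ℝ, Eu n)) (minSmoothness ℝ 2)
      (fun y => (⟨y, s y v⟩ : TangentBundle (𝓡 n) M)) x := fun v =>
    (hs.contMDiffAt hx v).of_le (by
      rw [minSmoothness_of_isRCLikeNormedField]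
      exact ENat.LEInfty.out)
  have : IsManifold (𝓡 n) (minSmoothness ℝ 3) M := IsManifold.of_le (n := ∞) (by
    rw [minSmoothness_of_isRCLikeNormedField]
    exact ENat.LEInfty.out)
  have h := VectorField.leibniz_identity_mlieBracket_apply (hsm u) (hsm v) (hsm w)
  -- Swapping `[[u,v],w]` puts every term into the nested form already computed.
  rw [VectorField.mlieBracket_swap_apply (V := VectorField.mlieBracket (𝓡 n) _ _),
    hs.mlieBracket_mlieBracket_frame hx hsmooth hD, hs.mlieBracket_mlieBracket_frame hx hsmooth hD,
    hs.mlieBracket_mlieBracket_frame hx hsmooth hD, ← map_neg, ← map_add] at h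
  have h' := (s x).injective h
  rw [h']
  simp only [bracketCoeff, map_sub, sub_apply]
  abel

end IsSmoothFrame

end FrameEquations

/-- The tensors that are three-forms. -/
def skewTensors (n : ℕ) : Submodule ℝ (Tc n) where
  carrier := {α | (∀ v w, α v w = -α w v) ∧ ∀ v w z, inner ℝ (α v w) z = -inner ℝ (α v z) w}
  zero_mem' := by simp
  add_mem' := by
    rintro α β ⟨hα, hα'⟩ ⟨hβ, hβ'⟩
    refine ⟨fun v w => ?_, fun v w z => ?_⟩
    · rw [add_apply, add_apply, add_apply, add_apply, hα, hβ]
      abel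
    · rw [add_apply, add_apply, add_apply, inner_add_left, inner_add_left, hα', hβ']
      ring
  smul_mem' := by
    rintro c α ⟨hα, hα'⟩
    refine ⟨fun v w => ?_, fun v w z => ?_⟩
    · rw [smul_apply, smul_apply, smul_apply, smul_apply, hα, smul_neg]
    · rw [smul_apply, smul_apply, smul_apply, real_inner_smul_left, real_inner_smul_left, hα']
      ring

/-- The action of `so(n)` preserves three-forms. -/
lemma derivAct_mem_skewTensors {A : Eu n →L[ℝ] Eu n}
    (hA : ∀ v w, inner ℝ (A v) w = -inner ℝ v (A w)) {α : Tc n} (hα : α ∈ skewTensors n) :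
    derivAct A α ∈ skewTensors n := by
  obtain ⟨h1, h2⟩ := hα
  refine ⟨fun v w => ?_, fun v w z => ?_⟩
  · rw [derivAct_apply, derivAct_apply, h1 v w, h1 (A v) w, h1 v (A w), map_neg]
    abel
  · simp only [derivAct_apply, inner_sub_left, hA, h2 v w (A z), h2 (A v) w z, h2 v (A w) z]
    rw [h2 v z (A w)]
    have e : inner ℝ (α v z) (A w) = -inner ℝ (α v (A w)) z := h2 v z (A w)
    linarith

/-! ### The covariant derivative of the torsion in frames of the `G`-structure. -/

section

variable {M : Type*} [TopologicalSpace M] [T2Space M] [ChartedSpace (Eu n) M]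
  [IsManifold (𝓡 n) ∞ M] [RiemannianBundle (fun x : M => TangentSpace (𝓡 n) x)]
  [IsContMDiffRiemannianBundle (𝓡 n) ∞ (Eu n) (fun x : M => TangentSpace (𝓡 n) x)]
  {U : Set M} {s : ∀ y : M, Eu n ≃ₗᵢ[ℝ] TangentSpace (𝓡 n) y} {x : M}
  {Dg D : Conn (n := n) M}

/-- The difference tensor of two connections, in a frame. -/
def diffCoeff (Dg D : Conn (n := n) M) (s : ∀ y : M, Eu n ≃ₗᵢ[ℝ] TangentSpace (𝓡 n) y) (y : M) :
    Tc n :=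
  connCoeff Dg s y - connCoeff D s y

/-- The covariant derivative of the difference tensor, in a frame. -/
def covDiffCoeff (Dg D : Conn (n := n) M) (s : ∀ y : M, Eu n ≃ₗᵢ[ℝ] TangentSpace (𝓡 n) y)
    (x : M) : Eu n →ₗ[ℝ] Tc n where
  toFun u := (connCoeffDeriv Dg s x u - connCoeffDeriv D s x u) +
    derivAct (connCoeff D s x u) (diffCoeff Dg D s x)
  map_add' u v := by
    ext w z : 2
    simp only [connCoeffDeriv, map_add, add_apply, sub_apply, derivAct_apply]
    abel
  map_smul' c u := by
    ext w z : 2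
    simp only [connCoeffDeriv, map_smul, add_apply, sub_apply, derivAct_apply, smul_apply,
      RingHom.id_apply, smul_sub, smul_add]

namespace IsSmoothFrame

lemma diffTensor_frame (hs : IsSmoothFrame U s) (hx : x ∈ U) (Dg D : Conn (n := n) M)
    (v w : Eu n) : diffTensor Dg D x (s x v) (s x w) = s x (diffCoeff Dg D s x v w) := by
  have h := IsCovariantDerivativeOn.difference_apply Dg.isCovariantDerivativeOnUniv
    D.isCovariantDerivativeOnUniv (Set.mem_univ x) (hs.mdifferentiableAt hx w)
  have h' : diffTensor Dg D x (s x v) (s x w) =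
      (Dg (fun y => s y w) x - D (fun y => s y w) x) (s x v) := congrArg (fun T => T (s x v)) h
  rw [h', sub_apply, hs.cov_frame hx, hs.cov_frame hx, ← map_sub]
  rfl

lemma inFrame_diffTensor (hs : IsSmoothFrame U s) (hx : x ∈ U) (Dg D : Conn (n := n) M) :
    inFrame (s x) (diffTensor Dg D x) = toTors (diffCoeff Dg D s x) := by
  ext v w : 2
  change (s x).symm (diffTensor Dg D x (s x v) (s x w)) = diffCoeff Dg D s x v w
  rw [hs.diffTensor_frame hx, LinearIsometryEquiv.symm_apply_apply]

lemma mvfderiv_diffCoeff (hs : IsSmoothFrame U s) (hx : x ∈ U)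
    (hDg : Dg.ContMDiffCovariantDerivative ∞) (hD : D.ContMDiffCovariantDerivative ∞) (u : Eu n) :
    mvfderiv (𝓡 n) (diffCoeff Dg D s) x (s x u) =
      connCoeffDeriv Dg s x u - connCoeffDeriv D s x u := by
  have h := mvfderiv_sub (hs.mdifferentiableAt_connCoeff hx hDg)
    (hs.mdifferentiableAt_connCoeff hx hD)
  exact congrArg (fun T => T (s x u)) h

lemma mdifferentiableAt_diffCoeff (hs : IsSmoothFrame U s) (hx : x ∈ U)
    (hDg : Dg.ContMDiffCovariantDerivative ∞) (hD : D.ContMDiffCovariantDerivative ∞) :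
    MDifferentiableAt (𝓡 n) 𝓘(ℝ, Tc n) (diffCoeff Dg D s) x :=
  (hs.mdifferentiableAt_connCoeff hx hDg).sub (hs.mdifferentiableAt_connCoeff hx hD)

/-- The covariant derivative of the difference tensor, evaluated in a frame. -/
lemma covDeriv_diffTensor (hs : IsSmoothFrame U s) (hx : x ∈ U)
    (hDg : Dg.ContMDiffCovariantDerivative ∞) (hD : D.ContMDiffCovariantDerivative ∞)
    {f h : M → Eu n} (hf : MDifferentiableAt (𝓡 n) 𝓘(ℝ, Eu n) f x)
    (hh : MDifferentiableAt (𝓡 n) 𝓘(ℝ, Eu n) h x) (u : Eu n) :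
    covDeriv D (diffTensor Dg D) x (s x u) (fun y => s y (f y)) (fun y => s y (h y)) =
      s x (covDiffCoeff Dg D s x u (f x) (h x)) := by
  have hΞ := hs.mdifferentiableAt_diffCoeff hx hDg hD
  have hΞf := hΞ.clm_apply hf
  have hk := hΞf.clm_apply hh
  have hsec := hs.mdifferentiableAt_apply hx hk
  have e : ∀ᶠ y in 𝓝 x, diffTensor Dg D y (s y (f y)) (s y (h y)) =
      s y (diffCoeff Dg D s y (f y) (h y)) :=
    (hs.isOpen.eventually_mem hx).mono fun y hy => hs.diffTensor_frame hy Dg D _ _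
  have hsec' : SecDiffAt (fun y => diffTensor Dg D y (s y (f y)) (s y (h y))) x :=
    hsec.congr_of_eventuallyEq (e.mono fun y hy =>
      congrArg (fun z => (⟨y, z⟩ : TangentBundle (𝓡 n) M)) hy)
  have hD1 : D (fun y => diffTensor Dg D y (s y (f y)) (s y (h y))) x =
      D (fun y => s y (diffCoeff Dg D s y (f y) (h y))) x :=
    D.isCovariantDerivativeOnUniv.congr_of_eventuallyEq hsec' hsec Filter.univ_mem e
  -- After the product rule the derivatives of `f` and `h` cancel, which is the tensoriality of the
  -- covariant derivative.
  rw [covDeriv, hD1, hs.cov_apply hx D hk, hs.cov_apply hx D hf, hs.cov_apply hx D hh,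
    hs.diffTensor_frame hx, hs.diffTensor_frame hx, ← map_sub, ← map_sub,
    mvfderiv_clm_apply hΞf hh, mvfderiv_clm_apply hΞ hf, hs.mvfderiv_diffCoeff hx hDg hD]
  congr 1
  simp only [covDiffCoeff, LinearMap.coe_mk, AddHom.coe_mk, add_apply, derivAct_apply, map_add]
  abel

end IsSmoothFrame

variable {G : Subgroup (On n)} {P : GStructure M G}

lemma GStructure.IsLocalSection.isSmoothFrame (hs : P.IsLocalSection U s) : IsSmoothFrame U s :=
  ⟨hs.isOpen, hs.smooth⟩

lemma IsGConnection.connCoeff_mem (hD : IsGConnection P D) (hs : P.IsLocalSection U s)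
    (hx : x ∈ U) (v : Eu n) : connCoeff D s x v ∈ lieAlgC G := by
  obtain ⟨A, hA, h⟩ := hD.form_mem U s hs x hx (s x v)
  rw [mem_lieAlgC_iff]
  convert hA
  ext w : 1
  have h1 := h w
  rw [hs.isSmoothFrame.cov_frame hx] at h1
  exact (s x).injective h1

lemma IsGConnection.connCoeffDeriv_mem (hD : IsGConnection P D) (hs : P.IsLocalSection U s)
    (hx : x ∈ U) (u v : Eu n) : connCoeffDeriv D s x u v ∈ lieAlgC G := by
  have h1 := hs.isSmoothFrame.mdifferentiableAt_connCoeff hx hD.smooth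
  have h2 := mfderiv_apply_mem_submodule (lieAlgC G)
    (h1.clm_apply (mdifferentiableAt_const (c := v)))
    ((hs.isOpen.eventually_mem hx).mono fun y hy => hD.connCoeff_mem hs hy v) (s x u)
  have h3 := mvfderiv_clm_apply h1 (mdifferentiableAt_const (c := v)) (s x u)
  rw [mvfderiv_const, zero_apply, map_zero, add_zero] at h3
  rw [connCoeffDeriv, ← h3]
  exact h2

/-- Any `c` is allowed: the bracket term is a value of the connection form, already in `𝔤`. -/
lemma IsGConnection.curv_mem (hD : IsGConnection P D) (hs : P.IsLocalSection U s)
    (hx : x ∈ U) (c : Eu n → Eu n → Eu n) (u v : Eu n) :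
    curv (connCoeff D s x) (connCoeffDeriv D s x) c u v ∈ lieAlgC G :=
  sub_mem (add_mem (sub_mem (hD.connCoeffDeriv_mem hs hx u v) (hD.connCoeffDeriv_mem hs hx v u))
    (commutator_mem_lieAlgC (hD.connCoeff_mem hs hx u) (hD.connCoeff_mem hs hx v)))
    (hD.connCoeff_mem hs hx _)

/-- If the difference tensor takes values in a submodule, so does its derivative in a frame. -/
lemma IsSmoothFrame.connCoeffDeriv_sub_mem (hs : IsSmoothFrame U s) (hx : x ∈ U)
    (hDg : Dg.ContMDiffCovariantDerivative ∞) (hD : D.ContMDiffCovariantDerivative ∞)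
    {S : Submodule ℝ (Tc n)} (hS : ∀ y ∈ U, diffCoeff Dg D s y ∈ S) (u : Eu n) :
    connCoeffDeriv Dg s x u - connCoeffDeriv D s x u ∈ S := by
  rw [← hs.mvfderiv_diffCoeff hx hDg hD]
  exact mfderiv_apply_mem_submodule S (hs.mdifferentiableAt_diffCoeff hx hDg hD)
    ((hs.isOpen.eventually_mem hx).mono hS) (s x u)

lemma IsSkew.diffCoeff_mem (hskew : IsSkew (diffTensor Dg D)) (hs : IsSmoothFrame U s)
    (hx : x ∈ U) : diffCoeff Dg D s x ∈ skewTensors n := by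
  refine ⟨fun v w => ?_, fun v w z => ?_⟩
  · refine ext_inner_right ℝ fun z => ?_
    have h := (hskew x (s x v) (s x w) (s x z)).1
    rw [hs.diffTensor_frame hx, hs.diffTensor_frame hx, LinearIsometryEquiv.inner_map_map,
      LinearIsometryEquiv.inner_map_map] at h
    rw [h, inner_neg_left]
  · have h := (hskew x (s x v) (s x w) (s x z)).2
    rwa [hs.diffTensor_frame hx, hs.diffTensor_frame hx, LinearIsometryEquiv.inner_map_map,
      LinearIsometryEquiv.inner_map_map] at h

/-- The intrinsic torsion is parallel in every frame of the `G`-structure. -/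
lemma covDiffCoeff_eq_zero (hDg : IsLeviCivita Dg) (hD : IsGConnection P D)
    (hskew : IsSkew (diffTensor Dg D)) {W : Subrepresentation (repTors G)}
    (hW : W.toSubmodule ≤ VPerp G) (hξW : TakesValuesIn P (diffTensor Dg D) W.toSubmodule)
    (hinv : (repVWSW G W).invariants = ⊥) (hs : P.IsLocalSection U s) (hx : x ∈ U) :
    covDiffCoeff Dg D s x = 0 := by
  have hf := hs.isSmoothFrame
  have hξ_skew : ∀ y ∈ U, diffCoeff Dg D s y ∈ skewTensors n := fun y hy =>
    hskew.diffCoeff_mem hf hy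
  have hξ_mem : ∀ y ∈ U, diffCoeff Dg D s y ∈ W.toSubmodule.comap toTors := fun y hy => by
    rw [Submodule.mem_comap, ← hf.inFrame_diffTensor hy]
    exact hξW y (s y) (hs.mem y hy)
  have hdξ_skew := hf.connCoeffDeriv_sub_mem hx hDg.smooth hD.smooth hξ_skew
  have hdξ_mem := hf.connCoeffDeriv_sub_mem hx hDg.smooth hD.smooth hξ_mem
  have hφ_skew : ∀ u, covDiffCoeff Dg D s x u ∈ skewTensors n := fun u =>
    add_mem (hdξ_skew u) (derivAct_mem_skewTensors
      (inner_apply_of_mem_lieAlgC (hD.connCoeff_mem hs hx u)) (hξ_skew x hx))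
  have hφ_mem : ∀ u, covDiffCoeff Dg D s x u ∈ W.toSubmodule.comap toTors := fun u =>
    add_mem (hdξ_mem u) (derivAct_mem W (hD.connCoeff_mem hs hx u) (hξ_mem x hx))
  refine eq_zero_of_cyclic (G := G) (ξ := diffCoeff Dg D s x)
    (Ω := curv (connCoeff D s x) (connCoeffDeriv D s x)
      (bracketCoeff (connCoeff D s x + diffCoeff Dg D s x)))
    (hξ_skew x hx).2 (fun u => (hφ_skew u).1) (fun u => (hφ_skew u).2) (fun u => hW (hφ_mem u))
    (hD.curv_mem hs hx _) ?_ (fun u => contr_psi_eq_zero hinv u (hφ_mem u) (hξ_mem x hx))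
  refine cyclic_curv_eq (dξ := fun u => connCoeffDeriv Dg s x u - connCoeffDeriv D s x u)
    (hξ_skew x hx).1 (fun u => (hdξ_skew u).1) fun u v w => ?_
  -- Minimal connection plus torsion is the Levi-Civita connection, whose Jacobi identity is
  -- available.
  have e : ∀ a b : Tc n, a + (b - a) = b := fun a b => by
    ext v w : 2
    simp only [add_apply, sub_apply]
    abel
  simp only [diffCoeff, e]
  exact hf.jacobi hx hDg.smooth hDg.torsion_eq_zero u v w

end

end GStr

end

theorem theorem5 {n : ℕ} {M : Type*} [TopologicalSpace M] [T2Space M] [SecondCountableTopology M]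
    [ChartedSpace (GStr.Eu n) M] [IsManifold (𝓡 n) ∞ M]
    [RiemannianBundle (fun x : M => TangentSpace (𝓡 n) x)]
    [IsContMDiffRiemannianBundle (𝓡 n) ∞ (GStr.Eu n) (fun x : M => TangentSpace (𝓡 n) x)]
    (G : Subgroup (GStr.On n)) (P : GStr.GStructure M G)
    (Dg D : GStr.Conn (n := n) M) (hDg : GStr.IsLeviCivita Dg)
    (hD : GStr.IsMinimalConnection P Dg D)
    (hskew : GStr.IsSkew (GStr.diffTensor Dg D))
    (W : Subrepresentation (GStr.repTors G)) (hW : W.toSubmodule ≤ GStr.VPerp G)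
    (hξW : GStr.TakesValuesIn P (GStr.diffTensor Dg D) W.toSubmodule)
    (hinv : (GStr.repVWSW G W).invariants = ⊥) :
    GStr.IsParallel D (GStr.diffTensor Dg D) := by
  intro x X Y Z hY hZ
  obtain ⟨U, s, hU, hx, hmem, hsmooth⟩ := P.exists_section x
  have hs : P.IsLocalSection U s := ⟨hU, hmem, hsmooth⟩
  have hf := hs.isSmoothFrame
  -- Arbitrary fields `Y`, `Z` and the direction `X` are written through the frame as `s (s⁻¹ Y)`,
  -- `s (s⁻¹ Z)` and `s (s⁻¹ X)`.
  have h := hf.covDeriv_diffTensor hx hDg.smooth hD.isGConnection.smooth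
    (hf.mdifferentiableAt_symm_apply hx hY) (hf.mdifferentiableAt_symm_apply hx hZ)
    ((s x).symm X)
  simp only [LinearIsometryEquiv.apply_symm_apply] at h
  rw [h, GStr.covDiffCoeff_eq_zero hDg hD.isGConnection hskew hW hξW hinv hs hx,
    LinearMap.zero_apply, zero_apply, zero_apply, map_zero]
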